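/- **Setting.** Let $\theta_k$ be a Markov chain on $\mathcal N=\{1,\dots,\nu\}$ with irreducible, aperiodic transition matrix $P=(p_{ij})$, and consider $x_{k+1}=f(x_k,u_k,\theta_k)$ on $\mathbb R^n$, with inputs in $\mathbb R^m$, constraints $(x_k,u_k)\in Y_{\theta_k}$ and stage cost $\ell(x,u,\theta)$. For each $\theta$ let $f(\cdot,\cdot,\theta)$ be continuous, let $Y_\theta$ be nonempty and compact, and let $\ell(\cdot,\cdot,\theta)$ be nonnegative, lower semicontinuous and level-bounded in $u$ locally uniformly in $x$. Assume that for every mode $\theta$ the point $(0,0)$ minimizes $\ell(\cdot,\cdot,\theta)$ over $\{(x,u)\in Y_\theta: f(x,u,\theta)=x\}$ (and belongs to this set), and that $f(\cdot,\cdot,\theta)$ is differentiable at $(0,0)$; put $A_i=\partial_x f(0,0,i)$, $B_i=\partial_u f(0,0,i)$. A system $x_{k+1}=F(x_k,\theta_k)$ is mean square stable on a family $D=\{D_i\}_{i\in\mathcal N}$ if $\mathbb E\|x_k\|^2\to0$ for all $\theta_0=i$ and $x_0\in D_i$; $D$ is uniformly positive invariant (UPI) if all $D_i$ are nonempty and $F(x,i)\in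 D_j$ whenever $x\in D_i$ and $p_{ij}>0$. For $V:\mathbb R^n\times\mathcal N\to\mathbb R$ write $\mathcal LV(x,i)=\mathbb E[V(x_{k+1},\theta_{k+1})-V(x_k,\theta_k)\mid x_k=x,\theta_k=i]$, and for a family $(T_j)_{j\in\mathcal N}$ write $\mathscr E_i(T)=\sum_j p_{ij}T_j$. Let $\kappa_f(x,i)=K_ix$, where the gains $K_i$ stabilize the linearization in mean square, i.e. $z_{k+1}=\Gamma_{\theta_k}z_k$ with $\Gamma_i=A_i+B_iK_i$ is mean square stable (for all initial states and modes). Let $\hat f_i(x)=f(x,K_ix,i)$ be $\beta_f^i$-smooth and $\bar\ell(x,i)=\ell(x,K_ix,i)-\ell(0,0,i)$ be $\beta_\ell^i$-smooth (differentiable on $\mathbb R^n$ with Lipschitz derivative of that constant). For $\alpha>0$ put $q_i=\nabla\bar\ell(0,i)$, $\ell_q(x,i)=\tfrac12(\alpha+\beta_\ell^i)\|x\|^2+q_i^\top x$ and $$V_f(x,i)=\mathbb E\Big[\sum_{k\ge0}\ell_q(x_k,\theta_k)\Big],\qquad x_{k+1}=\Gamma_{\theta_k}x_k,\ x_0=x,\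 \theta_0=i .$$ **Theorem.** (a) There are positive semidefinite matrices $P^I_i,P^\beta_i$ and vectors $p_i$ with $P^I_i=I+\Gamma_i^\top\mathscr E_i(P^I)\Gamma_i$, $P^\beta_i=\beta^i_\ell I+\Gamma_i^\top\mathscr E_i(P^\beta)\Gamma_i$ and $p_i=q_i+\Gamma_i^\top\mathscr E_i(p)$ such that for every $\alpha>0$ the series defining $V_f$ converges almost surely to an integrable limit and $V_f(x,i)=\tfrac12x^\top(P^\beta_i+\alpha P^I_i)x+p_i^\top x$. (b) There are $\delta>0$ and $\alpha_0>0$ such that for every $\alpha\ge\alpha_0$, along $x_{k+1}=\hat f_{\theta_k}(x_k)$, $\mathcal LV_f(x,i)\le-\bar\ell(x,i)$ for all $i\in\mathcal N$ and all $\|x\|<\delta$. (c) With these $\delta$ and $\alpha\ge\alpha_0$, let $X^f=\{X^f_i\}$ be UPI for $x_{k+1}=\hat f_{\theta_k}(x_k)$, with $X^f_i\subseteq\{\|x\|<\delta\}$ and $(x,K_ix)\in Y_i$ for $x\in X^f_i$. Suppose that the system is strictly stochastically dissipative: there are $\lambda,\rho:\mathbb R^n\times\mathcal N\to\mathbb R$,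 with $\lambda(\cdot,i)$ lower semicontinuous, $\lambda(0,i)$ independent of $i$, $\rho(\cdot,i)$ convex, $\rho(0,i)=0$ and $\rho(x,i)>0$ for $x\ne0$, such that $$\sum_j p_{ij}\lambda(f(x,u,i),j)-\lambda(x,i)\le\ell(x,u,i)-\ell(0,0,i)-\rho(x,i)\quad\text{for all }(x,u)\in Y_i;$$ and suppose that $\rho(x,i)\ge\gamma\|x\|^2$ for all $x$ and $i$, with some $\gamma>0$. Then the controlled system is locally mean square stable, in the following sense. The system $x_{k+1}=f(x_k,\kappa_f(x_k,\theta_k),\theta_k)$ is mean square stable on $X^f$. Moreover, for every horizon $N\ge1$ let $X_{N,i}$ be the set of $x$ for which the problem of minimizing $$\mathbb E\Big[V_f(x_N,\theta_N)+\sum_{k<N}\ell(x_k,u_k,\theta_k)\Big]$$ over causal policies ($u_k$ a function of $\theta_0,\dots,\theta_k$), subject to the dynamics, $(x_0,\theta_0)=(x,i)$ and, almost surely, $(x_k,u_k)\in Y_{\theta_k}$ for $k<N$ and $x_N\in X^f_{\theta_N}$, is feasible. Then $X^f_i\subseteq X_{N,i}$, and for every receding horizon law $\hat\kappa_N$ (whose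 value at each $(x,i)$ with $x\in X_{N,i}$ is the first input of an optimizer) $\{X_{N,i}\}_i$ is UPI for the closed loop $x_{k+1}=f(x_k,\hat\kappa_N(x_k,\theta_k),\theta_k)$, which is mean square stable on $\{X_{N,i}\}_i$. -/

import Mathlib

open MeasureTheory ProbabilityTheory Filter Topology
open scoped NNReal ENNReal

noncomputable section

namespace EMPC

/-- `ℝⁿ` with its Euclidean norm. -/
abbrev Vec (n : ℕ) : Type := EuclideanSpace ℝ (Fin n)

/-- Mode sequences `(θ₀, θ₁, …)`; the mode process is the coordinate process `θ_k(ω) = ω k`. -/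
abbrev ModePath (ν : ℕ) : Type := ℕ → Fin ν

section MarkovChain

variable {ν : ℕ}

/-- The law of the next mode given the current mode `i`: the `i`-th row of `P`. -/
def stepPMF (P : Matrix.rowStochastic ℝ (Fin ν)) (i : Fin ν) : PMF (Fin ν) :=
  PMF.ofFintype (fun j => ENNReal.ofReal (P.1 i j)) (by
    rw [← ENNReal.ofReal_sum_of_nonneg
      (fun j _ => Matrix.nonneg_of_mem_rowStochastic P.2),
      Matrix.sum_row_of_mem_rowStochastic P.2, ENNReal.ofReal_one])

/-- The transition kernel from the history `(θ₀, …, θ_k)` to `θ_{k+1}`. -/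
def stepKernel (P : Matrix.rowStochastic ℝ (Fin ν)) (k : ℕ) :
    Kernel (Π _ : Finset.Iic k, Fin ν) (Fin ν) :=
  Kernel.ofFunOfCountable (fun h => (stepPMF P (h ⟨k, Finset.mem_Iic.2 le_rfl⟩)).toMeasure)

instance (P : Matrix.rowStochastic ℝ (Fin ν)) (k : ℕ) : IsMarkovKernel (stepKernel P k) :=
  ⟨fun h => by
    change IsProbabilityMeasure ((stepPMF P (h ⟨k, Finset.mem_Iic.2 le_rfl⟩)).toMeasure)
    infer_instance⟩

/-- The law on path space of the Markov chain with transition matrix `P` started in `θ₀ = i`. -/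
def chainLaw (P : Matrix.rowStochastic ℝ (Fin ν)) (i : Fin ν) : Measure (ModePath ν) :=
  Kernel.traj (X := fun _ : ℕ => Fin ν) (stepKernel P) 0 (fun _ => i)

instance (P : Matrix.rowStochastic ℝ (Fin ν)) (i : Fin ν) :
    IsProbabilityMeasure (chainLaw P i) := by
  unfold chainLaw
  infer_instance

/-- The finite-dimensional distributions of `chainLaw P i`. -/
theorem chainLaw_cylinder (P : Matrix.rowStochastic ℝ (Fin ν)) (i : Fin ν) (s : ModePath ν)
    (hs : s 0 = i) (n : ℕ) :
    chainLaw P i {ω | ∀ k ≤ n, ω k = s k} =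
      ENNReal.ofReal (∏ k ∈ Finset.range n, P.1 (s k) (s (k + 1))) := by
  have hset : ∀ n : ℕ, {ω : ModePath ν | ∀ k ≤ n, ω k = s k} =
      Preorder.frestrictLe (π := fun _ : ℕ => Fin ν) n ⁻¹'
        {Preorder.frestrictLe (π := fun _ : ℕ => Fin ν) n s} := by
    intro n
    ext ω
    simp [funext_iff]
  have hpart : ∀ n : ℕ, chainLaw P i {ω | ∀ k ≤ n, ω k = s k} =
      Kernel.partialTraj (X := fun _ : ℕ => Fin ν) (stepKernel P) 0 n (fun _ => i)
        {Preorder.frestrictLe (π := fun _ : ℕ => Fin ν) n s} := by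
    intro n
    rw [← Kernel.traj_map_frestrictLe_apply, Measure.map_apply (by fun_prop) (by measurability),
      ← hset, chainLaw]
  induction n with
  | zero =>
    rw [hpart, Kernel.partialTraj_self]
    have : Preorder.frestrictLe (π := fun _ : ℕ => Fin ν) 0 s = fun _ => i := by
      funext k
      obtain ⟨k, hk⟩ := k
      have : k = 0 := by simpa using hk
      subst this
      exact hs
    rw [this]
    simp [Kernel.id_apply]
  | succ n ih =>
    have h1 : {ω : ModePath ν | ∀ k ≤ n + 1, ω k = s k} =
        (fun x : ModePath ν => (Preorder.frestrictLe (π := fun _ : ℕ => Fin ν) n x, x (n + 1))) ⁻¹'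
          ({Preorder.frestrictLe (π := fun _ : ℕ => Fin ν) n s} ×ˢ {s (n + 1)}) := by
      ext ω
      have := Set.ext_iff.1 (hset n) ω
      simp only [Set.mem_ofPred_eq, Set.mem_preimage, Set.mem_singleton_iff] at this
      simp only [Set.mem_ofPred_eq, Set.mem_preimage, Set.mem_prod, Set.mem_singleton_iff, ← this]
      exact ⟨fun h => ⟨fun k hk => h k (by omega), h _ le_rfl⟩,
        fun h k hk => (Nat.le_succ_iff.1 hk).elim (h.1 k) (fun e => e ▸ h.2)⟩
    rw [h1, chainLaw, ← Measure.map_apply (by fun_prop) (by measurability),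
      ← Kernel.partialTraj_compProd_eq_map_traj (Nat.zero_le n),
      Measure.compProd_apply_prod (by measurability) (by measurability),
      lintegral_singleton, ← hpart, ih, Finset.prod_range_succ,
      ENNReal.ofReal_mul (Finset.prod_nonneg
        (fun k _ => Matrix.nonneg_of_mem_rowStochastic P.2)), mul_comm]
    congr 1
    change (stepPMF P (s n)).toMeasure {s (n + 1)} = _
    rw [PMF.toMeasure_apply_singleton _ _ (by measurability)]
    rfl

end MarkovChain

section Systems

variable {n m ν : ℕ}

/-- The trajectory of `x_{k+1} = F(x_k, θ_k)`, `x_0 = x`, along the mode sequence `ω`. -/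
def flow (F : Vec n → Fin ν → Vec n) (x : Vec n) (ω : ModePath ν) : ℕ → Vec n
  | 0 => x
  | k + 1 => F (flow F x ω k) (ω k)

/-- Mean square stability of `x_{k+1} = F(x_k, θ_k)` with domain of attraction `D`:
`𝔼‖x_k‖² → 0` for every initial mode `θ₀ = i` and every initial state `x₀ ∈ D i`. -/
def IsMSStableOn (P : Matrix.rowStochastic ℝ (Fin ν)) (F : Vec n → Fin ν → Vec n)
    (D : Fin ν → Set (Vec n)) : Prop :=
  ∀ i, ∀ x ∈ D i,
    Tendsto (fun k : ℕ => ∫ ω, ‖flow F x ω k‖ ^ 2 ∂(chainLaw P i)) atTop (𝓝 0)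

/-- Mean square stability (all initial states, all initial modes). -/
def IsMSStable (P : Matrix.rowStochastic ℝ (Fin ν)) (F : Vec n → Fin ν → Vec n) : Prop :=
  IsMSStableOn P F (fun _ => Set.univ)

/-- Uniform positive invariance of a family of nonempty sets for `x_{k+1} = F(x_k, θ_k)`. -/
def IsUPI (P : Matrix.rowStochastic ℝ (Fin ν)) (F : Vec n → Fin ν → Vec n)
    (C : Fin ν → Set (Vec n)) : Prop :=
  (∀ i, (C i).Nonempty) ∧ ∀ i j, 0 < P.1 i j → ∀ x ∈ C i, F x i ∈ C j

/-- `𝔼[V(x_{k+1}, θ_{k+1}) - V(x_k, θ_k) | x_k = x, θ_k = i]` when `x_{k+1} = y`. -/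
def drift (P : Matrix.rowStochastic ℝ (Fin ν)) (V : Vec n → Fin ν → ℝ) (y x : Vec n)
    (i : Fin ν) : ℝ :=
  ∫ ω, (V y (ω 1) - V x (ω 0)) ∂(chainLaw P i)

/-- The operator `𝓛` for `x_{k+1} = F(x_k, θ_k)`. -/
def generator (P : Matrix.rowStochastic ℝ (Fin ν)) (F : Vec n → Fin ν → Vec n)
    (V : Vec n → Fin ν → ℝ) (x : Vec n) (i : Fin ν) : ℝ :=
  drift P V (F x i) x i

/-- Average over the successor modes: `𝓔_i(T) = ∑_j p_{ij} T_j`. -/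
def modeAvg (P : Matrix.rowStochastic ℝ (Fin ν)) {M : Type*} [AddCommMonoid M] [Module ℝ M]
    (T : Fin ν → M) (i : Fin ν) : M :=
  ∑ j, P.1 i j • T j

/-- `β`-smoothness: differentiable with `β`-Lipschitz derivative. -/
def BetaSmooth {G : Type*} [NormedAddCommGroup G] [NormedSpace ℝ G] (β : ℝ≥0)
    (g : Vec n → G) : Prop :=
  Differentiable ℝ g ∧ LipschitzWith β (fderiv ℝ g)

/-- A function of `(x, u)` is level-bounded in `u` locally uniformly in `x`. -/
def LevelBoundedLocally (g : Vec n → Vec m → ℝ) : Prop :=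
  ∀ (c : ℝ) (x₀ : Vec n), ∃ W ∈ 𝓝 x₀,
    Bornology.IsBounded {p : Vec n × Vec m | p.1 ∈ W ∧ g p.1 p.2 ≤ c}

/-- Aperiodicity: for each mode the greatest common divisor of the possible return times is 1. -/
def IsAperiodic (P : Matrix (Fin ν) (Fin ν) ℝ) : Prop :=
  ∀ (i : Fin ν) (d : ℕ), (∀ k : ℕ, 1 ≤ k → 0 < (P ^ k) i i → d ∣ k) → d = 1

/-- The data of a constrained Markovian switching system with a stage cost: transition matrix `P`,
dynamics `x_{k+1} = f(x_k, u_k, θ_k)`, cost `ell(x, u, θ)`, constraints `(x_k, u_k) ∈ Y θ_k`. -/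
structure Plant (n m ν : ℕ) where
  P : Matrix.rowStochastic ℝ (Fin ν)
  f : Vec n → Vec m → Fin ν → Vec n
  ell : Vec n → Vec m → Fin ν → ℝ
  Y : Fin ν → Set (Vec n × Vec m)

namespace Plant

variable (S : Plant n m ν)

structure WellPosed : Prop where
  ell_nonneg : ∀ x u i, 0 ≤ S.ell x u i
  ell_lsc : ∀ i, LowerSemicontinuous (fun p : Vec n × Vec m => S.ell p.1 p.2 i)
  ell_levelBounded : ∀ i, LevelBoundedLocally (fun x u => S.ell x u i)
  f_continuous : ∀ i, Continuous (fun p : Vec n × Vec m => S.f p.1 p.2 i)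
  Y_nonempty : ∀ i, (S.Y i).Nonempty
  Y_compact : ∀ i, IsCompact (S.Y i)
  irreducible : S.P.1.IsIrreducible
  aperiodic : IsAperiodic S.P.1

/-- Admissible steady states of mode `i`. -/
def steadyStates (i : Fin ν) : Set (Vec n × Vec m) :=
  {p | S.f p.1 p.2 i = p.1 ∧ p ∈ S.Y i}

/-- The origin is an optimal steady state of every mode. -/
def CommonEquilibrium : Prop :=
  ∀ i, (0 : Vec n × Vec m) ∈ S.steadyStates i ∧
    IsMinOn (fun p : Vec n × Vec m => S.ell p.1 p.2 i) (S.steadyStates i) 0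

/-- Strict stochastic dissipativity with respect to the supply rate `ell(x, u, θ) - ell(0, 0, θ)`,
with storage function `lam` and with `rho` positive definite around the origin. -/
structure StrictlyDissipative (lam rho : Vec n → Fin ν → ℝ) : Prop where
  lam_lsc : ∀ i, LowerSemicontinuous (fun x => lam x i)
  lam_zero : ∀ i j, lam 0 i = lam 0 j
  rho_convex : ∀ i, ConvexOn ℝ Set.univ (fun x => rho x i)
  rho_zero : ∀ i, rho 0 i = 0
  rho_pos : ∀ i x, x ≠ 0 → 0 < rho x i
  dissipation : ∀ i x u, (x, u) ∈ S.Y i →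
    drift S.P lam (S.f x u i) x i ≤ S.ell x u i - S.ell 0 0 i - rho x i

/-- The system in closed loop with the state feedback `κ`. -/
def closedLoop (κ : Vec n → Fin ν → Vec m) (x : Vec n) (i : Fin ν) : Vec n :=
  S.f x (κ x i) i

/-- `A_i = ∂f_i/∂x (0, 0)`. -/
def A (i : Fin ν) : Vec n →L[ℝ] Vec n := fderiv ℝ (fun x => S.f x 0 i) 0

/-- `B_i = ∂f_i/∂u (0, 0)`. -/
def B (i : Fin ν) : Vec m →L[ℝ] Vec n := fderiv ℝ (fun u => S.f 0 u i) 0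

/-- The linear terminal control law `κ_f(x, i) = K_i x`. -/
def kappaF (K : Fin ν → (Vec n →L[ℝ] Vec m)) (x : Vec n) (i : Fin ν) : Vec m := K i x

/-- The shifted stage cost under the terminal law. -/
def ellBar (K : Fin ν → (Vec n →L[ℝ] Vec m)) (x : Vec n) (i : Fin ν) : ℝ :=
  S.ell x (kappaF K x i) i - S.ell 0 0 i

/-- `Γ_i = A_i + B_i K_i`. -/
def Gamma (K : Fin ν → (Vec n →L[ℝ] Vec m)) (i : Fin ν) : Vec n →L[ℝ] Vec n :=
  S.A i + (S.B i).comp (K i)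

/-- The gains `K` stabilize the linearization `z_{k+1} = A_{θ_k} z_k + B_{θ_k} u_k` in the mean
square sense. -/
def IsMSStabilizing (K : Fin ν → (Vec n →L[ℝ] Vec m)) : Prop :=
  IsMSStable S.P (fun z i => S.Gamma K i z)

/-- `q_i = ∇ellBar(0, i)`. -/
def q (K : Fin ν → (Vec n →L[ℝ] Vec m)) (i : Fin ν) : Vec n :=
  gradient (fun x => S.ellBar K x i) 0

/-- `ℓ_q(x, i) = ½ xᵀ (α + β_i) x + q_iᵀ x`. -/
def ellQ (K : Fin ν → (Vec n →L[ℝ] Vec m)) (β : Fin ν → ℝ≥0) (α : ℝ) (x : Vec n)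
    (i : Fin ν) : ℝ :=
  1 / 2 * inner ℝ x ((α + β i) • x) + inner ℝ (S.q K i) x

/-- The terms of the series defining the terminal cost, along the linear closed loop
`x_{k+1} = Γ_{θ_k} x_k`. -/
def costTerm (K : Fin ν → (Vec n →L[ℝ] Vec m)) (β : Fin ν → ℝ≥0) (α : ℝ) (x : Vec n)
    (ω : ModePath ν) (k : ℕ) : ℝ :=
  S.ellQ K β α (flow (fun z i => S.Gamma K i z) x ω k) (ω k)

/-- The terminal cost `V_f(x, i) = 𝔼[∑_k ℓ_q(x_k, θ_k) | x₀ = x, θ₀ = i]`. -/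
def Vf (K : Fin ν → (Vec n →L[ℝ] Vec m)) (β : Fin ν → ℝ≥0) (α : ℝ) (x : Vec n)
    (i : Fin ν) : ℝ :=
  ∫ ω, ∑' k, S.costTerm K β α x ω k ∂(chainLaw S.P i)

/-- The state trajectory under the input process `u`. -/
def openLoop (x : Vec n) (u : ℕ → ModePath ν → Vec m) (ω : ModePath ν) : ℕ → Vec n
  | 0 => x
  | k + 1 => S.f (openLoop x u ω k) (u k ω) (ω k)

/-- Feasibility of the control policy `u` for the horizon-`N` problem with terminal sets `Xf` and
initial condition `(x₀, θ₀) = (x, i)`: causality and (almost sure) constraint satisfaction. Only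
`u_0, …, u_{N-1}` matter. -/
structure Feasible (N : ℕ) (Xf : Fin ν → Set (Vec n)) (x : Vec n) (i : Fin ν)
    (u : ℕ → ModePath ν → Vec m) : Prop where
  causal : Adapted (Filtration.piLE (X := fun _ : ℕ => Fin ν)) u
  stage : ∀ᵐ ω ∂(chainLaw S.P i), ∀ k < N, (S.openLoop x u ω k, u k ω) ∈ S.Y (ω k)
  terminal : ∀ᵐ ω ∂(chainLaw S.P i), S.openLoop x u ω N ∈ Xf (ω N)

/-- The feasibility domain `X_N`. -/
def feasibleSet (N : ℕ) (Xf : Fin ν → Set (Vec n)) (i : Fin ν) : Set (Vec n) :=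
  {x | ∃ u, S.Feasible N Xf x i u}

/-- The cost `𝔼[V(x_N, θ_N) + ∑_{k<N} ell(x_k, u_k, θ_k)]` of a policy, terminal cost `V`. -/
def horizonCost (N : ℕ) (V : Vec n → Fin ν → ℝ) (x : Vec n) (i : Fin ν)
    (u : ℕ → ModePath ν → Vec m) : ℝ :=
  ∫ ω, (V (S.openLoop x u ω N) (ω N) +
    ∑ k ∈ Finset.range N, S.ell (S.openLoop x u ω k) (u k ω) (ω k)) ∂(chainLaw S.P i)

/-- `u` is an optimizer of the horizon-`N` problem at `(x, i)`. -/
def IsOptimizer (N : ℕ) (V : Vec n → Fin ν → ℝ) (Xf : Fin ν → Set (Vec n)) (x : Vec n)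
    (i : Fin ν) (u : ℕ → ModePath ν → Vec m) : Prop :=
  S.Feasible N Xf x i u ∧ ∀ w, S.Feasible N Xf x i w →
    S.horizonCost N V x i u ≤ S.horizonCost N V x i w

/-- `κ` is a receding horizon control law: at each feasible `(x, i)` it applies the first input of
an optimizer. -/
def IsMPCLaw (N : ℕ) (V : Vec n → Fin ν → ℝ) (Xf : Fin ν → Set (Vec n))
    (κ : Vec n → Fin ν → Vec m) : Prop :=
  ∀ i, ∀ x ∈ S.feasibleSet N Xf i, ∃ u, S.IsOptimizer N V Xf x i u ∧
    ∀ᵐ ω ∂(chainLaw S.P i), u 0 ω = κ x i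

end Plant

end Systems

end EMPC

end

open EMPC

/-!
Conditioning on the first transition turns expectations over mode paths into mode averages, so the
drift of a function along the chain is explicit and the Markov property is an induction on time.

Terminal cost. Mean square stability of `z_{k+1} = Γ_{θ_k} z_k` makes the submultiplicative sequence
of second moments of the transition operators tend to zero, hence summable (and its square roots
too). The Lyapunov equations are therefore solved by convergent series, and integrating the cost
termwise yields a quadratic plus a linear form. By smoothness `f̂_i(x) - Γ_i x = O(‖x‖²)`, so on a
small ball the form of `P^I` still decreases by `‖x‖² / 2` along the nonlinear system. The decrease
is multiplied by `α / 2`, which for large `α` absorbs the quadratic errors of all the other terms.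

Receding horizon. Dropping the first input of an optimizer and appending the terminal law gives a
feasible policy at the next state whose cost is no larger than that of the tail, so the optimal cost
has drift at most `-ell`. Adding the storage function turns this into a Lyapunov function with drift
at most `-γ‖x‖²`. Before that the cost `ell(0, 0, i)` is subtracted in each mode, which changes no
optimizer because the inputs do not influence the modes.
-/

namespace EMPC

section ModeAverage

variable {ν : ℕ} {M : Type*} [AddCommGroup M] [Module ℝ M]
  (P : Matrix.rowStochastic ℝ (Fin ν)) (i : Fin ν)

theorem transition_nonneg (j : Fin ν) : 0 ≤ P.1 i j :=
  Matrix.nonneg_of_mem_rowStochastic P.2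

theorem transition_sum : ∑ j, P.1 i j = 1 :=
  Matrix.sum_row_of_mem_rowStochastic P.2 i

theorem modeAvg_add (T T' : Fin ν → M) :
    modeAvg P (fun j => T j + T' j) i = modeAvg P T i + modeAvg P T' i := by
  simp only [modeAvg, smul_add, Finset.sum_add_distrib]

theorem modeAvg_sub (T T' : Fin ν → M) :
    modeAvg P (fun j => T j - T' j) i = modeAvg P T i - modeAvg P T' i := by
  simp only [modeAvg, smul_sub, Finset.sum_sub_distrib]

theorem modeAvg_smul (c : ℝ) (T : Fin ν → M) :
    modeAvg P (fun j => c • T j) i = c • modeAvg P T i := by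
  simp only [modeAvg, Finset.smul_sum, smul_comm c]

theorem modeAvg_const (a : M) : modeAvg P (fun _ => a) i = a := by
  rw [modeAvg, ← Finset.sum_smul, transition_sum, one_smul]

variable {P i}

theorem modeAvg_mono {T T' : Fin ν → ℝ} (h : ∀ j, 0 < P.1 i j → T j ≤ T' j) :
    modeAvg P T i ≤ modeAvg P T' i := by
  refine Finset.sum_le_sum fun j _ => ?_
  rcases (transition_nonneg P i j).eq_or_lt with hij | hij
  · simp only [← hij, zero_smul, le_refl]
  · exact smul_le_smul_of_nonneg_left (h j hij) hij.le

end ModeAverage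

section Chain

variable {ν : ℕ}

/-- The mode path that starts in `i` and continues with `ω`; it realises the first transition of
the chain on path space. -/
def consPath (i : Fin ν) (ω : ModePath ν) : ModePath ν
  | 0 => i
  | k + 1 => ω k

@[simp] theorem consPath_zero (i : Fin ν) (ω : ModePath ν) : consPath i ω 0 = i := rfl

@[simp] theorem consPath_succ (i : Fin ν) (ω : ModePath ν) (k : ℕ) :
    consPath i ω (k + 1) = ω k := rfl

theorem consPath_shift (ω : ModePath ν) : consPath (ω 0) (fun k => ω (k + 1)) = ω := by
  funext k
  cases k <;> rfl

theorem measurable_consPath (i : Fin ν) : Measurable (consPath i) := by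
  refine measurable_pi_lambda _ fun k => ?_
  cases k with
  | zero => exact measurable_const
  | succ k => exact measurable_pi_apply k

theorem measurableSet_mode_eq (k : ℕ) (i : Fin ν) : MeasurableSet {ω : ModePath ν | ω k = i} :=
  measurableSet_eq_fun (measurable_pi_apply k) measurable_const

theorem range_consPath (i : Fin ν) : Set.range (consPath i) = {ω : ModePath ν | ω 0 = i} := by
  ext ω
  constructor
  · rintro ⟨ω, rfl⟩
    rfl
  · rintro rfl
    exact ⟨_, consPath_shift ω⟩

theorem measurableEmbedding_consPath (i : Fin ν) : MeasurableEmbedding (consPath i) :=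
  MeasurableEmbedding.of_measurable_inverse (g := fun ω k => ω (k + 1)) (measurable_consPath i)
    (range_consPath i ▸ measurableSet_mode_eq 0 i)
    (measurable_pi_lambda _ fun k => measurable_pi_apply (k + 1)) fun _ => rfl

/-- The event that the modes agree with those of `s` up to and including time `n`. -/
def initialCylinder (s : ModePath ν) (n : ℕ) : Set (ModePath ν) := {ω | ∀ k ≤ n, ω k = s k}

theorem measurableSet_initialCylinder (s : ModePath ν) (n : ℕ) :
    MeasurableSet (initialCylinder s n) := by
  simp only [initialCylinder, Set.ofPred_forall]
  exact .iInter fun k => .iInter fun _ => measurableSet_mode_eq k (s k)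

theorem consPath_preimage_initialCylinder_of_ne {i : Fin ν} {s : ModePath ν} (hs : s 0 ≠ i)
    (n : ℕ) : consPath i ⁻¹' initialCylinder s n = ∅ :=
  Set.eq_empty_of_forall_notMem fun _ h => hs (h 0 n.zero_le).symm

theorem consPath_preimage_initialCylinder_zero (s : ModePath ν) :
    consPath (s 0) ⁻¹' initialCylinder s 0 = Set.univ :=
  Set.eq_univ_of_forall fun _ _ hk => by rw [Nat.le_zero.1 hk, consPath_zero]

theorem consPath_preimage_initialCylinder_succ (s : ModePath ν) (n : ℕ) :
    consPath (s 0) ⁻¹' initialCylinder s (n + 1) = initialCylinder (fun k => s (k + 1)) n := by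
  ext ω
  refine ⟨fun h k hk => h (k + 1) (Nat.succ_le_succ hk), fun h k hk => ?_⟩
  cases k with
  | zero => rfl
  | succ k => exact h k (Nat.succ_le_succ_iff.1 hk)

theorem measure_eq_of_initialCylinder {μ μ' : Measure (ModePath ν)} [IsFiniteMeasure μ]
    (h : ∀ s n, μ (initialCylinder s n) = μ' (initialCylinder s n)) : μ = μ' := by
  let marginal (I : Finset ℕ) := μ.map (I.restrict (π := fun _ : ℕ => Fin ν))
  have hlim : IsProjectiveLimit (α := fun _ : ℕ => Fin ν) μ marginal := fun _ => rfl
  have hproj : IsProjectiveMeasureFamily (α := fun _ : ℕ => Fin ν) marginal := fun I J hJI => by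
    simp only [marginal]
    rw [Measure.map_map (by fun_prop) (by fun_prop)]
    rfl
  refine hlim.unique ((isProjectiveLimit_nat_iff hproj μ').2 fun n => ?_)
  refine Measure.ext_of_singleton fun a => ?_
  have hpre : (Finset.Iic n).restrict (π := fun _ : ℕ => Fin ν) ⁻¹' {a} =
      initialCylinder (fun k => a ⟨min k n, Finset.mem_Iic.2 (min_le_right k n)⟩) n := by
    ext ω
    simp only [Set.mem_preimage, Set.mem_singleton_iff, funext_iff, Subtype.forall,
      Finset.mem_Iic, Finset.restrict]
    refine forall₂_congr fun k hk => ?_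
    simp only [min_eq_left hk]
  rw [Measure.map_apply (by fun_prop) (.singleton a),
    Measure.map_apply (by fun_prop) (.singleton a)]
  exact (congrArg μ' hpre).trans ((h _ n).symm.trans (congrArg μ hpre.symm))

theorem ae_mode_zero (P : Matrix.rowStochastic ℝ (Fin ν)) (i : Fin ν) :
    ∀ᵐ ω ∂(chainLaw P i), ω 0 = i := by
  have h := chainLaw_cylinder P i (fun _ => i) rfl 0
  simp only [nonpos_iff_eq_zero, forall_eq, Finset.range_zero, Finset.prod_empty,
    ENNReal.ofReal_one] at h
  exact (prob_compl_eq_zero_iff (measurableSet_mode_eq 0 i)).2 h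

theorem chainLaw_initialCylinder_of_ne (P : Matrix.rowStochastic ℝ (Fin ν)) {i : Fin ν}
    {s : ModePath ν} (hs : s 0 ≠ i) (n : ℕ) : chainLaw P i (initialCylinder s n) = 0 :=
  measure_mono_null (fun _ hω h => hs ((hω 0 n.zero_le).symm.trans h)) (ae_mode_zero P i)

theorem chainLaw_initialCylinder_zero (P : Matrix.rowStochastic ℝ (Fin ν)) (s : ModePath ν) :
    chainLaw P (s 0) (initialCylinder s 0) = 1 :=
  (chainLaw_cylinder P (s 0) s rfl 0).trans (by simp)

theorem chainLaw_initialCylinder_succ (P : Matrix.rowStochastic ℝ (Fin ν)) (s : ModePath ν)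
    (n : ℕ) :
    chainLaw P (s 0) (initialCylinder s (n + 1)) = ENNReal.ofReal (P.1 (s 0) (s 1)) *
      chainLaw P (s 1) (initialCylinder (fun k => s (k + 1)) n) := by
  have hsucc := chainLaw_cylinder P (s 0) s rfl (n + 1)
  rw [Finset.prod_range_succ', mul_comm, ENNReal.ofReal_mul (transition_nonneg P _ _)] at hsucc
  exact hsucc.trans (congrArg _ (chainLaw_cylinder P (s 1) (fun k => s (k + 1)) rfl n).symm)

theorem chainLaw_eq_sum (P : Matrix.rowStochastic ℝ (Fin ν)) (i : Fin ν) :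
    chainLaw P i = ∑ j, ENNReal.ofReal (P.1 i j) • (chainLaw P j).map (consPath i) := by
  refine measure_eq_of_initialCylinder fun s n => ?_
  simp only [Measure.finsetSum_apply, Measure.smul_apply, smul_eq_mul,
    Measure.map_apply (measurable_consPath i) (measurableSet_initialCylinder s n)]
  rcases eq_or_ne (s 0) i with rfl | hs
  · cases n with
    | zero =>
      simp only [chainLaw_initialCylinder_zero, consPath_preimage_initialCylinder_zero,
        measure_univ, mul_one]
      rw [← ENNReal.ofReal_sum_of_nonneg fun j _ => transition_nonneg P _ j, transition_sum,
        ENNReal.ofReal_one]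
    | succ n =>
      simp only [consPath_preimage_initialCylinder_succ]
      rw [chainLaw_initialCylinder_succ, Finset.sum_eq_single (s 1)]
      · intro j _ hj
        rw [chainLaw_initialCylinder_of_ne P (s := fun k => s (k + 1)) hj.symm, mul_zero]
      · simp
  · simp only [chainLaw_initialCylinder_of_ne P hs, consPath_preimage_initialCylinder_of_ne hs,
      measure_empty, mul_zero, Finset.sum_const_zero]

theorem ae_chainLaw_iff {P : Matrix.rowStochastic ℝ (Fin ν)} {i : Fin ν} {Q : ModePath ν → Prop} :
    (∀ᵐ ω ∂(chainLaw P i), Q ω) ↔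
      ∀ j, 0 < P.1 i j → ∀ᵐ ω ∂(chainLaw P j), Q (consPath i ω) := by
  rw [chainLaw_eq_sum P i, ae_iff]
  simp only [Measure.finsetSum_apply, Finset.sum_eq_zero_iff, Finset.mem_univ, true_imp_iff,
    Measure.smul_apply, smul_eq_mul, mul_eq_zero, ENNReal.ofReal_eq_zero, or_iff_not_imp_left,
    not_le, ← ae_iff, (measurableEmbedding_consPath i).ae_map_iff]

theorem ae_transition_pos (P : Matrix.rowStochastic ℝ (Fin ν)) (i : Fin ν) :
    ∀ᵐ ω ∂(chainLaw P i), ∀ k, 0 < P.1 (ω k) (ω (k + 1)) := by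
  rw [ae_all_iff]
  intro k
  induction k generalizing i with
  | zero =>
    refine ae_chainLaw_iff.2 fun j hij => ?_
    filter_upwards [ae_mode_zero P j] with ω hω
    simpa only [consPath_zero, consPath_succ, hω] using hij
  | succ k ih => exact ae_chainLaw_iff.2 fun j _ => ih j

section FiniteDependence

variable {E : Type*}

theorem measurable_of_dependsOn [MeasurableSpace E] {φ : ModePath ν → E} {k : ℕ}
    (hφ : DependsOn φ (Set.Iic k)) :
    Measurable[(Filtration.piLE (X := fun _ : ℕ => Fin ν)) k] φ := by
  intro s _
  refine ⟨Preorder.restrictLe k '' (φ ⁻¹' s), (Set.toFinite _).measurableSet, ?_⟩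
  ext ω
  refine ⟨?_, fun h => ⟨ω, h, rfl⟩⟩
  rintro ⟨ω', hω', h⟩
  have : φ ω = φ ω' := hφ fun l hl => (congrFun h ⟨l, hl⟩).symm
  simpa only [Set.mem_preimage, this] using hω'

theorem dependsOn_comp_consPath {φ : ModePath ν → E} {k : ℕ} (hφ : DependsOn φ (Set.Iic (k + 1)))
    (i : Fin ν) : DependsOn (fun ω => φ (consPath i ω)) (Set.Iic k) := by
  intro ω ω' h
  refine hφ fun l hl => ?_
  cases l with
  | zero => rfl
  | succ l => exact h l (Nat.succ_le_succ_iff.1 hl)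

theorem dependsOn_mode {T : Type*} (g : Fin ν → T) (k : ℕ) :
    DependsOn (fun ω : ModePath ν => g (ω k)) (Set.Iic k) := fun _ _ h =>
  congrArg g (h k Set.self_mem_Iic)

theorem dependsOn_of_recursion {x : ModePath ν → ℕ → E} {x₀ : E} {step : ℕ → E → ModePath ν → E}
    (hzero : ∀ ω, x ω 0 = x₀) (hsucc : ∀ ω k, x ω (k + 1) = step k (x ω k) ω)
    (hstep : ∀ k y, DependsOn (step k y) (Set.Iic k)) (k : ℕ) :
    DependsOn (fun ω => x ω k) (Set.Iio k) := by
  induction k with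
  | zero => exact fun ω ω' _ => (hzero ω).trans (hzero ω').symm
  | succ k ih =>
    intro ω ω' h
    simp only [hsucc, ih fun l hl => h l (hl.trans k.lt_succ_self)]
    exact hstep k _ fun l hl => h l (Nat.lt_succ_of_le hl)

variable [NormedAddCommGroup E]

theorem integrable_of_dependsOn {φ : ModePath ν → E} {k : ℕ} (hφ : DependsOn φ (Set.Iic k))
    (μ : Measure (ModePath ν)) [IsFiniteMeasure μ] : Integrable φ μ := by
  rw [← Finset.coe_Iic, dependsOn_iff_factorsThrough] at hφ
  obtain ⟨g, rfl⟩ := (Function.factorsThrough_iff φ).1 hφ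
  exact (Integrable.of_finite (f := g)).comp_measurable (by fun_prop)

variable [NormedSpace ℝ E]

theorem integral_chainLaw {φ : ModePath ν → E} {k : ℕ} (hφ : DependsOn φ (Set.Iic k))
    (P : Matrix.rowStochastic ℝ (Fin ν)) (i : Fin ν) :
    ∫ ω, φ ω ∂(chainLaw P i) = modeAvg P (fun j => ∫ ω, φ (consPath i ω) ∂(chainLaw P j)) i := by
  have hint : ∀ j, Integrable φ ((chainLaw P j).map (consPath i)) := fun j =>
    integrable_of_dependsOn hφ _
  rw [chainLaw_eq_sum P i, integral_finsetSum_measure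
    fun j _ => (hint j).smul_measure ENNReal.ofReal_ne_top]
  refine Finset.sum_congr rfl fun j _ => ?_
  rw [integral_smul_measure, ENNReal.toReal_ofReal (transition_nonneg P i j),
    (measurableEmbedding_consPath i).integral_map]

variable [CompleteSpace E]

theorem integral_chainLaw_of_forall_mode_zero (P : Matrix.rowStochastic ℝ (Fin ν)) {i : Fin ν}
    {φ : ModePath ν → E} {c : E} (hφ : ∀ ω, ω 0 = i → φ ω = c) :
    ∫ ω, φ ω ∂(chainLaw P i) = c := by
  rw [integral_congr_ae ((ae_mode_zero P i).mono hφ), integral_const, probReal_univ, one_smul]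

theorem integral_chainLaw_of_dependsOn_zero {φ : ModePath ν → E} (hφ : DependsOn φ (Set.Iic 0))
    (P : Matrix.rowStochastic ℝ (Fin ν)) (i : Fin ν) :
    ∫ ω, φ ω ∂(chainLaw P i) = φ fun _ => i := by
  refine integral_chainLaw_of_forall_mode_zero P fun ω hω => hφ fun l hl => ?_
  rw [Nat.le_zero.1 hl, hω]

theorem integral_markov (P : Matrix.rowStochastic ℝ (Fin ν)) (i : Fin ν) {k : ℕ}
    {Φ : Fin ν → ModePath ν → E} (hΦ : ∀ j, DependsOn (Φ j) (Set.Iic k)) :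
    ∫ ω, Φ (ω (k + 1)) ω ∂(chainLaw P i) =
      ∫ ω, modeAvg P (fun j => Φ j ω) (ω k) ∂(chainLaw P i) := by
  have hnext : DependsOn (fun ω => Φ (ω (k + 1)) ω) (Set.Iic (k + 1)) := fun ω ω' h => by
    simp only [h (k + 1) Set.self_mem_Iic]
    exact hΦ _ fun l hl => h l (Set.Iic_subset_Iic.2 k.le_succ hl)
  have havg : DependsOn (fun ω => modeAvg P (fun j => Φ j ω) (ω k)) (Set.Iic k) := fun ω ω' h => by
    simp only [h k Set.self_mem_Iic, hΦ _ h]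
  induction k generalizing i Φ with
  | zero =>
    rw [integral_chainLaw hnext, integral_chainLaw_of_dependsOn_zero havg]
    refine congrArg (modeAvg P · i) (funext fun j => ?_)
    refine integral_chainLaw_of_forall_mode_zero P fun ω hω => ?_
    rw [consPath_succ, hω]
    exact hΦ j fun l hl => by rw [Nat.le_zero.1 hl, consPath_zero]
  | succ k ih =>
    rw [integral_chainLaw hnext, integral_chainLaw havg]
    refine congrArg (modeAvg P · i) (funext fun j => ?_)
    exact ih j (fun j => dependsOn_comp_consPath (hΦ j) i) (dependsOn_comp_consPath hnext i)
      (dependsOn_comp_consPath havg i)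

end FiniteDependence

section Drift

variable {n : ℕ} (P : Matrix.rowStochastic ℝ (Fin ν)) (V W : Vec n → Fin ν → ℝ) (y x : Vec n)
  (i : Fin ν)

theorem drift_eq : drift P V y x i = modeAvg P (V y) i - V x i := by
  have hdep : DependsOn (fun ω : ModePath ν => V y (ω 1) - V x (ω 0)) (Set.Iic 1) := fun _ _ h => by
    simp only [h 1 Set.self_mem_Iic, h 0 (Set.mem_Iic.2 zero_le_one)]
  rw [drift, integral_chainLaw hdep, ← modeAvg_const P i (V x i), ← modeAvg_sub]
  refine congrArg (modeAvg P · i) (funext fun j => ?_)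
  exact integral_chainLaw_of_forall_mode_zero P fun ω hω => by
    rw [consPath_succ, consPath_zero, hω]

theorem drift_add :
    drift P (fun z j => V z j + W z j) y x i = drift P V y x i + drift P W y x i := by
  simp only [drift_eq, modeAvg_add]
  ring

theorem drift_const_mul (c : ℝ) : drift P (fun z j => c * V z j) y x i = c * drift P V y x i := by
  simp only [drift_eq, ← smul_eq_mul, modeAvg_smul, smul_sub]

end Drift

end Chain

section Lyapunov

variable {n ν : ℕ}

theorem dependsOn_flow_Iio (F : Vec n → Fin ν → Vec n) (x : Vec n) (k : ℕ) :
    DependsOn (fun ω => flow F x ω k) (Set.Iio k) :=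
  dependsOn_of_recursion (step := fun k y ω => F y (ω k)) (fun _ => rfl) (fun _ _ => rfl)
    (fun k y => dependsOn_mode (F y) k) k

theorem dependsOn_flow_mode {E : Type*} (F : Vec n → Fin ν → Vec n) (x : Vec n)
    (g : Vec n → Fin ν → E) (k : ℕ) :
    DependsOn (fun ω => g (flow F x ω k) (ω k)) (Set.Iic k) := fun _ _ h =>
  congrArg₂ g (dependsOn_flow_Iio F x k fun l hl => h l (Set.Iio_subset_Iic_self hl))
    (h k Set.self_mem_Iic)

theorem integrable_flow_mode {E : Type*} [NormedAddCommGroup E]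
    (P : Matrix.rowStochastic ℝ (Fin ν)) (F : Vec n → Fin ν → Vec n) (x : Vec n) (i : Fin ν)
    (g : Vec n → Fin ν → E) (k : ℕ) :
    Integrable (fun ω => g (flow F x ω k) (ω k)) (chainLaw P i) :=
  integrable_of_dependsOn (dependsOn_flow_mode F x g k) _

theorem integral_flow_succ (P : Matrix.rowStochastic ℝ (Fin ν)) (F : Vec n → Fin ν → Vec n)
    (W : Vec n → Fin ν → ℝ) (x : Vec n) (i : Fin ν) (k : ℕ) :
    ∫ ω, W (flow F x ω (k + 1)) (ω (k + 1)) ∂(chainLaw P i) =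
      ∫ ω, W (flow F x ω k) (ω k) ∂(chainLaw P i) +
        ∫ ω, generator P F W (flow F x ω k) (ω k) ∂(chainLaw P i) := by
  rw [integral_markov P i (Φ := fun j ω => W (flow F x ω (k + 1)) j)
    fun j => dependsOn_flow_mode F x (fun y i => W (F y i) j) k,
    ← integral_add (integrable_flow_mode P F x i W k)
      (integrable_flow_mode P F x i (generator P F W) k)]
  simp only [generator, drift_eq, flow, add_sub_cancel]

theorem ae_flow_mem {P : Matrix.rowStochastic ℝ (Fin ν)} {F : Vec n → Fin ν → Vec n}
    {D : Fin ν → Set (Vec n)} (hD : ∀ i j, 0 < P.1 i j → ∀ x ∈ D i, F x i ∈ D j)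
    {i : Fin ν} {x : Vec n} (hx : x ∈ D i) :
    ∀ᵐ ω ∂(chainLaw P i), ∀ k, flow F x ω k ∈ D (ω k) := by
  filter_upwards [ae_mode_zero P i, ae_transition_pos P i] with ω hzero hpos k
  induction k with
  | zero => exact hzero ▸ hx
  | succ k ih => exact hD _ _ (hpos k) _ ih

theorem isMSStableOn_of_lyapunov {P : Matrix.rowStochastic ℝ (Fin ν)}
    {F : Vec n → Fin ν → Vec n} {D : Fin ν → Set (Vec n)}
    (hD : ∀ i j, 0 < P.1 i j → ∀ x ∈ D i, F x i ∈ D j)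
    {W : Vec n → Fin ν → ℝ} {c γ : ℝ} (hγ : 0 < γ) (hc : ∀ i, ∀ x ∈ D i, c ≤ W x i)
    (hW : ∀ i, ∀ x ∈ D i, generator P F W x i ≤ -(γ * ‖x‖ ^ 2)) :
    IsMSStableOn P F D := by
  intro i x hx
  have hmem := ae_flow_mem hD hx
  let a (k : ℕ) : ℝ := ∫ ω, W (flow F x ω k) (ω k) ∂(chainLaw P i)
  let e (k : ℕ) : ℝ := ∫ ω, ‖flow F x ω k‖ ^ 2 ∂(chainLaw P i)
  have hsq (k : ℕ) : Integrable (fun ω => ‖flow F x ω k‖ ^ 2) (chainLaw P i) :=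
    integrable_flow_mode P F x i (fun y _ => ‖y‖ ^ 2) k
  have hstep (k : ℕ) : a (k + 1) ≤ a k - γ * e k := by
    have hgen : ∫ ω, generator P F W (flow F x ω k) (ω k) ∂(chainLaw P i) ≤ -(γ * e k) := by
      rw [← integral_const_mul, ← integral_neg]
      exact integral_mono_ae (integrable_flow_mode P F x i (generator P F W) k)
        ((hsq k).const_mul γ).neg (hmem.mono fun ω hω => hW _ _ (hω k))
    linarith [integral_flow_succ P F W x i k]
  have hlower (k : ℕ) : c ≤ a k := by
    simpa only [integral_const, probReal_univ, one_smul] using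
      integral_mono_ae (integrable_const c) (integrable_flow_mode P F x i W k)
        (hmem.mono fun ω hω => hc _ _ (hω k))
  have htelescope (T : ℕ) : ∑ k ∈ Finset.range T, e k * γ ≤ a 0 - a T := by
    rw [← Finset.sum_range_sub']
    exact Finset.sum_le_sum fun k _ => by linarith [hstep k]
  have hsummable : Summable e := by
    refine summable_of_sum_range_le (c := (a 0 - c) / γ)
      (fun k => integral_nonneg fun ω => sq_nonneg _) fun T => ?_
    rw [le_div_iff₀ hγ, Finset.sum_mul]
    linarith [htelescope T, hlower T]
  exact hsummable.tendsto_atTop_zero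

end Lyapunov

section Analysis

theorem summable_of_submultiplicative_of_tendsto_zero {a : ℕ → ℝ} (hnonneg : ∀ k, 0 ≤ a k)
    (hmul : ∀ k l, a (k + l) ≤ a k * a l) (hlim : Tendsto a atTop (𝓝 0)) : Summable a := by
  obtain ⟨L, hL⟩ := (hlim.eventually_le_const (u := 1 / 2) (by norm_num)).exists
  refine summable_of_sum_range_le (c := 2 * ∑ k ∈ Finset.range L, a k) hnonneg fun T => ?_
  have hmono : ∑ k ∈ Finset.range T, a k ≤ ∑ k ∈ Finset.range (L + T), a k :=
    Finset.sum_le_sum_of_subset_of_nonneg (Finset.range_subset_range.2 (T.le_add_left L))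
      fun k _ _ => hnonneg k
  have htail : ∑ k ∈ Finset.range T, a (L + k) ≤ 1 / 2 * ∑ k ∈ Finset.range T, a k := by
    rw [Finset.mul_sum]
    exact Finset.sum_le_sum fun k _ =>
      (hmul L k).trans (mul_le_mul_of_nonneg_right hL (hnonneg k))
  rw [Finset.sum_range_add] at hmono
  linarith

theorem exists_integrable_ae_hasSum {Ω ι E : Type*} [MeasurableSpace Ω] {μ : Measure Ω}
    [Countable ι] [NormedAddCommGroup E] [CompleteSpace E] {F : ι → Ω → E}
    (hF : ∀ k, Integrable (F k) μ) (hs : Summable fun k => ∫ ω, ‖F k ω‖ ∂μ) :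
    ∃ G : Ω → E, Integrable G μ ∧ ∀ᵐ ω ∂μ, HasSum (fun k => F k ω) (G ω) := by
  have henorm : ∑' k, ‖(hF k).toL1 (F k)‖ₑ ≠ ∞ := by
    refine tsum_enorm_ne_top_iff_summable_norm.2 ?_
    simpa only [L1.norm_of_fun_eq_integral_norm] using hs
  refine ⟨_, L1.integrable_coeFn (∑' k, (hF k).toL1 (F k)), ?_⟩
  filter_upwards [Lp.hasSum_coeFn_tsum henorm, ae_all_iff.2 fun k => (hF k).coeFn_toL1]
    with ω hsum heq
  simpa only [heq] using hsum

theorem sq_opNorm_le_sum_orthonormalBasis {𝕜 ι E G : Type*} [RCLike 𝕜] [Fintype ι]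
    [NormedAddCommGroup E] [InnerProductSpace 𝕜 E] [NormedAddCommGroup G] [NormedSpace 𝕜 G]
    (b : OrthonormalBasis ι 𝕜 E) (A : E →L[𝕜] G) : ‖A‖ ^ 2 ≤ ∑ a, ‖A (b a)‖ ^ 2 := by
  refine (Real.le_sqrt (norm_nonneg _) (Finset.sum_nonneg fun a _ => sq_nonneg _)).1 ?_
  refine A.opNorm_le_bound (Real.sqrt_nonneg _) fun x => ?_
  calc ‖A x‖ = ‖∑ a, b.repr x a • A (b a)‖ := by
        conv_lhs => rw [← b.sum_repr x, map_sum]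
        simp only [map_smul]
    _ ≤ ∑ a, ‖b.repr x a‖ * ‖A (b a)‖ :=
        (norm_sum_le _ _).trans_eq (Finset.sum_congr rfl fun a _ => norm_smul _ _)
    _ ≤ √(∑ a, ‖b.repr x a‖ ^ 2) * √(∑ a, ‖A (b a)‖ ^ 2) := Real.sum_mul_le_sqrt_mul_sqrt _ _ _
    _ = √(∑ a, ‖A (b a)‖ ^ 2) * ‖x‖ := by
        rw [← EuclideanSpace.norm_eq, b.repr.norm_map, mul_comm]

theorem integral_norm_le_sqrt_integral_sq {Ω E : Type*} [MeasurableSpace Ω] {μ : Measure Ω}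
    [IsProbabilityMeasure μ] [NormedAddCommGroup E] {φ : Ω → E} (hφ : Integrable φ μ)
    (hsq : Integrable (fun ω => ‖φ ω‖ ^ 2) μ) :
    ∫ ω, ‖φ ω‖ ∂μ ≤ √(∫ ω, ‖φ ω‖ ^ 2 ∂μ) :=
  Real.le_sqrt_of_sq_le <| even_two.convexOn_pow.map_integral_le (by fun_prop) isClosed_univ
    (by simp) hφ.norm hsq

end Analysis

section Linear

variable {n ν : ℕ} (Γ : Fin ν → (Vec n →L[ℝ] Vec n))

/-- The transition operator `Φ_k = Γ_{θ_{k-1}} ⋯ Γ_{θ_0}` of `x_{k+1} = Γ_{θ_k} x_k` from time `0`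
to time `k`. -/
noncomputable def linFlow (ω : ModePath ν) : ℕ → (Vec n →L[ℝ] Vec n)
  | 0 => ContinuousLinearMap.id ℝ (Vec n)
  | k + 1 => (Γ (ω k)).comp (linFlow ω k)

theorem flow_eq_linFlow (x : Vec n) (ω : ModePath ν) (k : ℕ) :
    flow (fun z i => Γ i z) x ω k = linFlow Γ ω k x := by
  induction k with
  | zero => rfl
  | succ k ih => exact congrArg (Γ (ω k)) ih

theorem linFlow_consPath_succ (i : Fin ν) (ω : ModePath ν) (k : ℕ) :
    linFlow Γ (consPath i ω) (k + 1) = (linFlow Γ ω k).comp (Γ i) := by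
  induction k with
  | zero => rfl
  | succ k ih => exact congrArg (Γ (ω k)).comp ih

theorem dependsOn_linFlow_mode {E : Type*} (g : (Vec n →L[ℝ] Vec n) → Fin ν → E) (k : ℕ) :
    DependsOn (fun ω => g (linFlow Γ ω k) (ω k)) (Set.Iic k) := by
  have hflow : DependsOn (fun ω => linFlow Γ ω k) (Set.Iio k) :=
    dependsOn_of_recursion (step := fun k A ω => (Γ (ω k)).comp A) (fun _ => rfl)
      (fun _ _ => rfl) (fun k A => dependsOn_mode (fun i => (Γ i).comp A) k) k
  exact fun _ _ h => congrArg₂ g (hflow fun l hl => h l (Set.Iio_subset_Iic_self hl))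
    (h k Set.self_mem_Iic)

variable (P : Matrix.rowStochastic ℝ (Fin ν))

theorem integrable_linFlow_mode {E : Type*} [NormedAddCommGroup E]
    (g : (Vec n →L[ℝ] Vec n) → Fin ν → E) (k : ℕ) (i : Fin ν) :
    Integrable (fun ω => g (linFlow Γ ω k) (ω k)) (chainLaw P i) :=
  integrable_of_dependsOn (dependsOn_linFlow_mode Γ g k) _

theorem integral_linFlow_succ {E : Type*} [NormedAddCommGroup E] [NormedSpace ℝ E]
    (g : (Vec n →L[ℝ] Vec n) → Fin ν → E) (k : ℕ) (i : Fin ν) :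
    ∫ ω, g (linFlow Γ ω (k + 1)) (ω (k + 1)) ∂(chainLaw P i) =
      modeAvg P (fun j => ∫ ω, g ((linFlow Γ ω k).comp (Γ i)) (ω k) ∂(chainLaw P j)) i := by
  rw [integral_chainLaw (dependsOn_linFlow_mode Γ g (k + 1))]
  simp only [linFlow_consPath_succ, consPath_succ]

/-- The sum over the initial modes of `𝔼‖Φ_k‖²`. Summing makes the sequence submultiplicative. -/
noncomputable def flowMoment (k : ℕ) : ℝ := ∑ i, ∫ ω, ‖linFlow Γ ω k‖ ^ 2 ∂(chainLaw P i)

theorem flowMoment_nonneg (k : ℕ) : 0 ≤ flowMoment Γ P k :=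
  Finset.sum_nonneg fun _ _ => integral_nonneg fun _ => sq_nonneg _

theorem integral_sq_norm_linFlow_le (k : ℕ) (i : Fin ν) :
    ∫ ω, ‖linFlow Γ ω k‖ ^ 2 ∂(chainLaw P i) ≤ flowMoment Γ P k :=
  Finset.single_le_sum (f := fun i => ∫ ω, ‖linFlow Γ ω k‖ ^ 2 ∂(chainLaw P i))
    (fun _ _ => integral_nonneg fun _ => sq_nonneg _) (Finset.mem_univ i)

theorem integral_norm_linFlow_le (k : ℕ) (i : Fin ν) :
    ∫ ω, ‖linFlow Γ ω k‖ ∂(chainLaw P i) ≤ √(flowMoment Γ P k) :=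
  (integral_norm_le_sqrt_integral_sq (integrable_linFlow_mode Γ P (fun A _ => A) k i)
    (integrable_linFlow_mode Γ P (fun A _ => ‖A‖ ^ 2) k i)).trans
    (Real.sqrt_le_sqrt (integral_sq_norm_linFlow_le Γ P k i))

theorem integral_sq_norm_linFlow_comp_le (k l : ℕ) (A : Vec n →L[ℝ] Vec n) (i : Fin ν) :
    ∫ ω, ‖(linFlow Γ ω (k + l)).comp A‖ ^ 2 ∂(chainLaw P i) ≤
      flowMoment Γ P l * ∫ ω, ‖(linFlow Γ ω k).comp A‖ ^ 2 ∂(chainLaw P i) := by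
  induction k generalizing i A with
  | zero =>
    rw [zero_add]
    simp only [linFlow, ContinuousLinearMap.id_comp, integral_const, probReal_univ, one_smul]
    calc ∫ ω, ‖(linFlow Γ ω l).comp A‖ ^ 2 ∂(chainLaw P i)
        ≤ ∫ ω, ‖linFlow Γ ω l‖ ^ 2 * ‖A‖ ^ 2 ∂(chainLaw P i) := by
          refine integral_mono (integrable_linFlow_mode Γ P (fun B _ => ‖B.comp A‖ ^ 2) l i)
            (integrable_linFlow_mode Γ P (fun B _ => ‖B‖ ^ 2 * ‖A‖ ^ 2) l i) fun ω => ?_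
          simp only [← mul_pow]
          gcongr
          exact ContinuousLinearMap.opNorm_comp_le _ _
      _ ≤ flowMoment Γ P l * ‖A‖ ^ 2 := by
          rw [integral_mul_const]
          gcongr
          exact integral_sq_norm_linFlow_le Γ P l i
  | succ k ih =>
    rw [Nat.add_right_comm, integral_linFlow_succ Γ P (fun B _ => ‖B.comp A‖ ^ 2),
      integral_linFlow_succ Γ P (fun B _ => ‖B.comp A‖ ^ 2), ← smul_eq_mul, ← modeAvg_smul]
    simp only [ContinuousLinearMap.comp_assoc]
    exact modeAvg_mono fun j _ => ih ((Γ i).comp A) j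

theorem flowMoment_add_le (k l : ℕ) :
    flowMoment Γ P (k + l) ≤ flowMoment Γ P k * flowMoment Γ P l := by
  rw [mul_comm, flowMoment, flowMoment.eq_1 Γ P k, Finset.mul_sum]
  refine Finset.sum_le_sum fun i _ => ?_
  simpa only [ContinuousLinearMap.comp_id] using
    integral_sq_norm_linFlow_comp_le Γ P k l (ContinuousLinearMap.id ℝ (Vec n)) i

variable {Γ P}

theorem tendsto_flowMoment (h : IsMSStable P (fun z i => Γ i z)) :
    Tendsto (flowMoment Γ P) atTop (𝓝 0) := by
  let e := EuclideanSpace.basisFun (Fin n) ℝ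
  have hbasis : Tendsto (fun k => ∑ i, ∑ a, ∫ ω, ‖linFlow Γ ω k (e a)‖ ^ 2 ∂(chainLaw P i))
      atTop (𝓝 (∑ _ : Fin ν, ∑ _ : Fin n, 0)) :=
    tendsto_finsetSum _ fun i _ => tendsto_finsetSum _ fun a _ => by
      simpa only [flow_eq_linFlow] using h i (e a) (Set.mem_univ _)
  simp only [Finset.sum_const_zero] at hbasis
  refine squeeze_zero (flowMoment_nonneg Γ P) (fun k => Finset.sum_le_sum fun i _ => ?_) hbasis
  rw [← integral_finsetSum _ fun a _ => integrable_linFlow_mode Γ P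
    (fun A _ => ‖A (e a)‖ ^ 2) k i]
  exact integral_mono (integrable_linFlow_mode Γ P (fun A _ => ‖A‖ ^ 2) k i)
    (integrable_linFlow_mode Γ P (fun A _ => ∑ a, ‖A (e a)‖ ^ 2) k i)
    fun ω => sq_opNorm_le_sum_orthonormalBasis e _

theorem summable_flowMoment (h : IsMSStable P (fun z i => Γ i z)) : Summable (flowMoment Γ P) :=
  summable_of_submultiplicative_of_tendsto_zero (flowMoment_nonneg Γ P) (flowMoment_add_le Γ P)
    (tendsto_flowMoment h)

theorem summable_sqrt_flowMoment (h : IsMSStable P (fun z i => Γ i z)) :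
    Summable fun k => √(flowMoment Γ P k) := by
  refine summable_of_submultiplicative_of_tendsto_zero (fun k => Real.sqrt_nonneg _)
    (fun k l => ?_) ?_
  · rw [← Real.sqrt_mul (flowMoment_nonneg Γ P k)]
    exact Real.sqrt_le_sqrt (flowMoment_add_le Γ P k l)
  · simpa only [Real.sqrt_zero] using (tendsto_flowMoment h).sqrt

end Linear

section LyapunovEquation

variable {n ν : ℕ} (P : Matrix.rowStochastic ℝ (Fin ν)) (Γ : Fin ν → (Vec n →L[ℝ] Vec n))
  (w : Fin ν → ℝ) (q : Fin ν → Vec n)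

theorem tsum_eq_of_modeAvg_recursion {P : Matrix.rowStochastic ℝ (Fin ν)} {M : Type*}
    [NormedAddCommGroup M] [NormedSpace ℝ M] {g : Fin ν → ℕ → M} (hg : ∀ i, Summable (g i))
    {i : Fin ν} {L : M →L[ℝ] M} (hsucc : ∀ k, g i (k + 1) = L (modeAvg P (fun j => g j k) i)) :
    ∑' k, g i k = g i 0 + L (modeAvg P (fun j => ∑' k, g j k) i) := by
  have havg : HasSum (fun k => modeAvg P (fun j => g j k) i)
      (modeAvg P (fun j => ∑' k, g j k) i) :=
    hasSum_sum fun j _ => (hg j).hasSum.const_smul _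
  rw [(hg i).tsum_eq_zero_add]
  simp only [hsucc]
  rw [(havg.mapL L).tsum_eq]

/-- The linear map `T ↦ Aᵀ T A`. -/
noncomputable def congruence (A : Vec n →L[ℝ] Vec n) :
    (Vec n →L[ℝ] Vec n) →L[ℝ] (Vec n →L[ℝ] Vec n) :=
  (ContinuousLinearMap.compL ℝ _ _ _ (ContinuousLinearMap.adjoint A)).comp
    ((ContinuousLinearMap.compL ℝ _ _ _).flip A)

theorem congruence_apply (A T : Vec n →L[ℝ] Vec n) :
    congruence A T = (ContinuousLinearMap.adjoint A).comp (T.comp A) := rfl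

/-- The quadratic form `𝔼[w(θ_k) ‖x_k‖²]` along `x_{k+1} = Γ_{θ_k} x_k`, as an operator. -/
noncomputable def stageOp (i : Fin ν) (k : ℕ) : Vec n →L[ℝ] Vec n :=
  ∫ ω, w (ω k) • (ContinuousLinearMap.adjoint (linFlow Γ ω k)).comp (linFlow Γ ω k)
    ∂(chainLaw P i)

/-- The linear form `𝔼⟪q(θ_k), x_k⟫` along `x_{k+1} = Γ_{θ_k} x_k`, as a vector. -/
noncomputable def stageVec (i : Fin ν) (k : ℕ) : Vec n :=
  ∫ ω, ContinuousLinearMap.adjoint (linFlow Γ ω k) (q (ω k)) ∂(chainLaw P i)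

theorem stageOp_zero (i : Fin ν) :
    stageOp P Γ w i 0 = w i • ContinuousLinearMap.id ℝ (Vec n) :=
  integral_chainLaw_of_forall_mode_zero P fun ω hω => by
    simp [linFlow, hω, ContinuousLinearMap.adjoint_id]

theorem stageOp_succ (i : Fin ν) (k : ℕ) :
    stageOp P Γ w i (k + 1) = congruence (Γ i) (modeAvg P (fun j => stageOp P Γ w j k) i) := by
  rw [stageOp, integral_linFlow_succ Γ P
    (fun A j => w j • (ContinuousLinearMap.adjoint A).comp A), modeAvg, modeAvg, map_sum]
  refine Finset.sum_congr rfl fun j _ => ?_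
  rw [map_smul, stageOp, ← (congruence (Γ i)).integral_comp_comm (integrable_linFlow_mode Γ P
    (fun A j => w j • (ContinuousLinearMap.adjoint A).comp A) k j)]
  simp only [map_smul, congruence_apply, ContinuousLinearMap.adjoint_comp,
    ContinuousLinearMap.comp_assoc]

theorem stageVec_zero (i : Fin ν) : stageVec P Γ q i 0 = q i :=
  integral_chainLaw_of_forall_mode_zero P fun ω hω => by
    simp [linFlow, hω, ContinuousLinearMap.adjoint_id]

theorem stageVec_succ (i : Fin ν) (k : ℕ) :
    stageVec P Γ q i (k + 1) =
      ContinuousLinearMap.adjoint (Γ i) (modeAvg P (fun j => stageVec P Γ q j k) i) := by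
  rw [stageVec, integral_linFlow_succ Γ P (fun A j => ContinuousLinearMap.adjoint A (q j)),
    modeAvg, modeAvg, map_sum]
  refine Finset.sum_congr rfl fun j _ => ?_
  rw [map_smul, stageVec, ← (ContinuousLinearMap.adjoint (Γ i)).integral_comp_comm
    (integrable_linFlow_mode Γ P (fun A j => ContinuousLinearMap.adjoint A (q j)) k j)]
  simp only [ContinuousLinearMap.adjoint_comp, ContinuousLinearMap.comp_apply]

theorem inner_stageOp (i : Fin ν) (k : ℕ) (x y : Vec n) :
    inner ℝ y (stageOp P Γ w i k x) =
      ∫ ω, w (ω k) * inner ℝ (linFlow Γ ω k y) (linFlow Γ ω k x) ∂(chainLaw P i) := by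
  have h := ((innerSL ℝ y).comp (ContinuousLinearMap.apply ℝ (Vec n) x)).integral_comp_comm
    (integrable_linFlow_mode Γ P
      (fun A j => w j • (ContinuousLinearMap.adjoint A).comp A) k i)
  simp only [ContinuousLinearMap.comp_apply, ContinuousLinearMap.apply_apply,
    innerSL_apply_apply, smul_apply, inner_smul_right,
    ContinuousLinearMap.adjoint_inner_right] at h
  exact h.symm

theorem inner_stageVec (i : Fin ν) (k : ℕ) (x : Vec n) :
    inner ℝ (stageVec P Γ q i k) x =
      ∫ ω, inner ℝ (q (ω k)) (linFlow Γ ω k x) ∂(chainLaw P i) := by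
  have h := (innerSL ℝ x).integral_comp_comm
    (integrable_linFlow_mode Γ P (fun A j => ContinuousLinearMap.adjoint A (q j)) k i)
  simp only [innerSL_apply_apply, ContinuousLinearMap.adjoint_inner_right] at h
  rw [real_inner_comm, stageVec, ← h]
  simp only [real_inner_comm]

theorem norm_stageOp_le (i : Fin ν) (k : ℕ) :
    ‖stageOp P Γ w i k‖ ≤ ‖w‖ * flowMoment Γ P k := by
  calc ‖stageOp P Γ w i k‖
      ≤ ∫ ω, ‖w (ω k) • (ContinuousLinearMap.adjoint (linFlow Γ ω k)).comp (linFlow Γ ω k)‖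
        ∂(chainLaw P i) := norm_integral_le_integral_norm _
    _ ≤ ∫ ω, ‖w‖ * ‖linFlow Γ ω k‖ ^ 2 ∂(chainLaw P i) := by
        refine integral_mono (integrable_linFlow_mode Γ P
          (fun A j => ‖w j • (ContinuousLinearMap.adjoint A).comp A‖) k i)
          (integrable_linFlow_mode Γ P (fun A _ => ‖w‖ * ‖A‖ ^ 2) k i) fun ω => ?_
        simp only [norm_smul, ContinuousLinearMap.norm_adjoint_comp_self, ← sq]
        gcongr
        exact norm_le_pi_norm w _
    _ ≤ ‖w‖ * flowMoment Γ P k := by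
        rw [integral_const_mul]
        gcongr
        exact integral_sq_norm_linFlow_le Γ P k i

theorem norm_stageVec_le (i : Fin ν) (k : ℕ) :
    ‖stageVec P Γ q i k‖ ≤ ‖q‖ * √(flowMoment Γ P k) := by
  calc ‖stageVec P Γ q i k‖
      ≤ ∫ ω, ‖ContinuousLinearMap.adjoint (linFlow Γ ω k) (q (ω k))‖ ∂(chainLaw P i) :=
        norm_integral_le_integral_norm _
    _ ≤ ∫ ω, ‖q‖ * ‖linFlow Γ ω k‖ ∂(chainLaw P i) := by
        refine integral_mono (integrable_linFlow_mode Γ P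
          (fun A j => ‖ContinuousLinearMap.adjoint A (q j)‖) k i)
          (integrable_linFlow_mode Γ P (fun A _ => ‖q‖ * ‖A‖) k i) fun ω => ?_
        refine (ContinuousLinearMap.le_opNorm _ _).trans ?_
        rw [LinearIsometryEquiv.norm_map, mul_comm]
        gcongr
        exact norm_le_pi_norm q _
    _ ≤ ‖q‖ * √(flowMoment Γ P k) := by
        rw [integral_const_mul]
        gcongr
        exact integral_norm_linFlow_le Γ P k i

/-- The solution `P_i = ∑_k 𝔼[w(θ_k) Φ_kᵀ Φ_k]` of the coupled Lyapunov equations. -/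
noncomputable def lyapOp (i : Fin ν) : Vec n →L[ℝ] Vec n := ∑' k, stageOp P Γ w i k

/-- The solution `p_i = ∑_k 𝔼[Φ_kᵀ q(θ_k)]` of the coupled linear equations. -/
noncomputable def lyapVec (i : Fin ν) : Vec n := ∑' k, stageVec P Γ q i k

variable {P Γ}

theorem summable_stageOp (h : IsMSStable P (fun z i => Γ i z)) (i : Fin ν) :
    Summable (stageOp P Γ w i) :=
  Summable.of_norm_bounded ((summable_flowMoment h).mul_left _) (norm_stageOp_le P Γ w i)

theorem summable_stageVec (h : IsMSStable P (fun z i => Γ i z)) (i : Fin ν) :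
    Summable (stageVec P Γ q i) :=
  Summable.of_norm_bounded ((summable_sqrt_flowMoment h).mul_left _) (norm_stageVec_le P Γ q i)

theorem hasSum_inner_stageOp (h : IsMSStable P (fun z i => Γ i z)) (i : Fin ν) (x y : Vec n) :
    HasSum (fun k => inner ℝ y (stageOp P Γ w i k x)) (inner ℝ y (lyapOp P Γ w i x)) :=
  (summable_stageOp w h i).hasSum.mapL
    ((innerSL ℝ y).comp (ContinuousLinearMap.apply ℝ (Vec n) x))

theorem hasSum_inner_stageVec (h : IsMSStable P (fun z i => Γ i z)) (i : Fin ν) (x : Vec n) :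
    HasSum (fun k => inner ℝ (stageVec P Γ q i k) x) (inner ℝ (lyapVec P Γ q i) x) := by
  simp only [real_inner_comm x]
  exact (summable_stageVec q h i).hasSum.mapL (innerSL ℝ x)

theorem lyapOp_eq (h : IsMSStable P (fun z i => Γ i z)) (i : Fin ν) :
    lyapOp P Γ w i = w i • ContinuousLinearMap.id ℝ (Vec n) +
      (ContinuousLinearMap.adjoint (Γ i)).comp ((modeAvg P (lyapOp P Γ w) i).comp (Γ i)) := by
  rw [← stageOp_zero P Γ w i, ← congruence_apply]
  exact tsum_eq_of_modeAvg_recursion (summable_stageOp w h) (stageOp_succ P Γ w i)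

theorem lyapVec_eq (h : IsMSStable P (fun z i => Γ i z)) (i : Fin ν) :
    lyapVec P Γ q i = q i + ContinuousLinearMap.adjoint (Γ i) (modeAvg P (lyapVec P Γ q) i) := by
  rw [← stageVec_zero P Γ q i]
  exact tsum_eq_of_modeAvg_recursion (summable_stageVec q h) (stageVec_succ P Γ q i)

theorem isPositive_lyapOp {w : Fin ν → ℝ} (hw : ∀ i, 0 ≤ w i)
    (h : IsMSStable P (fun z i => Γ i z)) (i : Fin ν) : (lyapOp P Γ w i).IsPositive := by
  have hsymm : ∀ k x y, inner ℝ y (stageOp P Γ w i k x) = inner ℝ x (stageOp P Γ w i k y) :=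
    fun k x y => by simp only [inner_stageOp, real_inner_comm]
  refine ⟨fun x y => ?_, fun x => ?_⟩
  · rw [real_inner_comm]
    refine (hasSum_inner_stageOp w h i x y).unique ?_
    simp only [hsymm _ x y]
    exact hasSum_inner_stageOp w h i y x
  · rw [ContinuousLinearMap.reApplyInnerSelf_apply, real_inner_comm]
    refine (hasSum_inner_stageOp w h i x x).nonneg fun k => ?_
    rw [inner_stageOp]
    exact integral_nonneg fun ω => mul_nonneg (hw _) real_inner_self_nonneg

end LyapunovEquation

section Drift

theorem BetaSmooth.norm_sub_sub_fderiv_le {n : ℕ} {G : Type*} [NormedAddCommGroup G]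
    [NormedSpace ℝ G] {β : ℝ≥0} {g : Vec n → G} (hg : BetaSmooth β g) (x : Vec n) :
    ‖g x - g 0 - fderiv ℝ g 0 x‖ ≤ β * ‖x‖ ^ 2 := by
  have hderiv : ∀ y ∈ Metric.closedBall (0 : Vec n) ‖x‖,
      ‖fderiv ℝ g y - fderiv ℝ g 0‖ ≤ β * ‖x‖ := fun y hy => by
    refine (hg.2.norm_sub_le y 0).trans ?_
    rw [sub_zero]
    gcongr
    exact mem_closedBall_zero_iff.1 hy
  have hmvt := (convex_closedBall (0 : Vec n) ‖x‖).norm_image_sub_le_of_norm_fderiv_le'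
    (fun y _ => hg.1 y) hderiv (Metric.mem_closedBall_self (norm_nonneg x))
    (mem_closedBall_zero_iff.2 le_rfl)
  rwa [sub_zero, mul_assoc, ← sq] at hmvt

theorem inner_add_map_add_le {E : Type*} [NormedAddCommGroup E] [InnerProductSpace ℝ E]
    (T : E →L[ℝ] E) (u r : E) :
    inner ℝ (u + r) (T (u + r)) ≤ inner ℝ u (T u) + ‖T‖ * (2 * ‖u‖ + ‖r‖) * ‖r‖ := by
  have hbil : ∀ a b : E, inner ℝ a (T b) ≤ ‖a‖ * (‖T‖ * ‖b‖) := fun a b =>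
    (real_inner_le_norm _ _).trans (by gcongr; exact T.le_opNorm b)
  rw [map_add, inner_add_left, inner_add_right, inner_add_right]
  linarith [hbil u r, hbil r u, hbil r r]

variable {n ν : ℕ} (P : Matrix.rowStochastic ℝ (Fin ν)) (Γ : Fin ν → (Vec n →L[ℝ] Vec n))

/-- The quadratic function `x ↦ xᵀ P_i x` of the solution `lyapOp` of the Lyapunov equations. -/
noncomputable def lyapQuad (w : Fin ν → ℝ) (x : Vec n) (i : Fin ν) : ℝ :=
  inner ℝ x (lyapOp P Γ w i x)

/-- The linear function `x ↦ p_iᵀ x` of the solution `lyapVec` of the linear equations. -/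
noncomputable def lyapLin (q : Fin ν → Vec n) (x : Vec n) (i : Fin ν) : ℝ :=
  inner ℝ (lyapVec P Γ q i) x

variable {P Γ} {b : ℝ} {x y : Vec n} {i : Fin ν}

theorem drift_lyapQuad (h : IsMSStable P (fun z i => Γ i z)) (w : Fin ν → ℝ) :
    drift P (lyapQuad P Γ w) y x i = inner ℝ y (modeAvg P (lyapOp P Γ w) i y) -
      inner ℝ (Γ i x) (modeAvg P (lyapOp P Γ w) i (Γ i x)) - w i * ‖x‖ ^ 2 := by
  have hquad : lyapQuad P Γ w x i =
      w i * ‖x‖ ^ 2 + inner ℝ (Γ i x) (modeAvg P (lyapOp P Γ w) i (Γ i x)) := by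
    rw [lyapQuad, lyapOp_eq w h, add_apply, inner_add_right, smul_apply, inner_smul_right,
      ContinuousLinearMap.id_apply, real_inner_self_eq_norm_sq, ContinuousLinearMap.comp_apply,
      ContinuousLinearMap.adjoint_inner_right, ContinuousLinearMap.comp_apply]
  have havg : modeAvg P (lyapQuad P Γ w y) i = inner ℝ y (modeAvg P (lyapOp P Γ w) i y) := by
    simp only [modeAvg, lyapQuad, sum_apply, smul_apply, inner_sum, inner_smul_right, smul_eq_mul]
  rw [drift_eq, hquad, havg]
  ring

theorem drift_lyapLin (h : IsMSStable P (fun z i => Γ i z)) (q : Fin ν → Vec n) :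
    drift P (lyapLin P Γ q) y x i =
      inner ℝ (modeAvg P (lyapVec P Γ q) i) (y - Γ i x) - inner ℝ (q i) x := by
  have hlin : lyapLin P Γ q x i =
      inner ℝ (q i) x + inner ℝ (modeAvg P (lyapVec P Γ q) i) (Γ i x) := by
    rw [lyapLin, lyapVec_eq q h, inner_add_left, ContinuousLinearMap.adjoint_inner_left]
  have havg : modeAvg P (lyapLin P Γ q y) i = inner ℝ (modeAvg P (lyapVec P Γ q) i) y := by
    simp only [modeAvg, lyapLin, sum_inner, real_inner_smul_left, smul_eq_mul]
  rw [drift_eq, hlin, havg, inner_sub_right]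
  ring

theorem drift_lyapQuad_le (h : IsMSStable P (fun z i => Γ i z)) (w : Fin ν → ℝ) (hb : 0 ≤ b)
    (hx : ‖x‖ ≤ 1) (hy : ‖y - Γ i x‖ ≤ b * ‖x‖ ^ 2) :
    drift P (lyapQuad P Γ w) y x i ≤
      ‖modeAvg P (lyapOp P Γ w)‖ * (2 * ‖Γ‖ + b) * b * ‖x‖ ^ 3 - w i * ‖x‖ ^ 2 := by
  have hΓ : ‖Γ i x‖ ≤ ‖Γ‖ * ‖x‖ := (Γ i).le_of_opNorm_le (norm_le_pi_norm Γ i) x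
  have hr : ‖y - Γ i x‖ ≤ b * ‖x‖ := hy.trans (by gcongr; nlinarith [norm_nonneg x])
  have hquad := inner_add_map_add_le (modeAvg P (lyapOp P Γ w) i) (Γ i x) (y - Γ i x)
  rw [add_sub_cancel] at hquad
  have hrem : ‖modeAvg P (lyapOp P Γ w) i‖ * (2 * ‖Γ i x‖ + ‖y - Γ i x‖) * ‖y - Γ i x‖ ≤
      ‖modeAvg P (lyapOp P Γ w)‖ * (2 * (‖Γ‖ * ‖x‖) + b * ‖x‖) * (b * ‖x‖ ^ 2) := by
    gcongr
    exact norm_le_pi_norm _ i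
  rw [drift_lyapQuad h]
  linarith

theorem drift_lyapLin_le (h : IsMSStable P (fun z i => Γ i z)) (q : Fin ν → Vec n)
    (hy : ‖y - Γ i x‖ ≤ b * ‖x‖ ^ 2) :
    drift P (lyapLin P Γ q) y x i ≤
      ‖modeAvg P (lyapVec P Γ q)‖ * b * ‖x‖ ^ 2 - inner ℝ (q i) x := by
  rw [drift_lyapLin h, mul_assoc]
  gcongr
  refine (real_inner_le_norm _ _).trans ?_
  gcongr
  exact norm_le_pi_norm _ i

theorem exists_ball_generator_lyapQuad_le (h : IsMSStable P (fun z i => Γ i z))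
    {F : Vec n → Fin ν → Vec n} (hb : 0 ≤ b)
    (hF : ∀ x i, ‖F x i - Γ i x‖ ≤ b * ‖x‖ ^ 2) :
    ∃ δ, 0 < δ ∧ δ ≤ 1 ∧ ∀ i, ∀ x ∈ Metric.ball (0 : Vec n) δ,
      generator P F (lyapQuad P Γ 1) x i ≤ -(1 / 2 * ‖x‖ ^ 2) := by
  obtain ⟨c, hc⟩ : ∃ c, c = ‖modeAvg P (lyapOp P Γ 1)‖ * (2 * ‖Γ‖ + b) * b := ⟨_, rfl⟩
  have hc0 : 0 ≤ c := by rw [hc]; positivity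
  refine ⟨1 / (2 * (c + 1)), by positivity, ?_, fun i x hx => ?_⟩
  · rw [div_le_one (by positivity)]
    linarith
  · have hxc := mem_ball_zero_iff.1 hx
    rw [lt_div_iff₀ (by positivity)] at hxc
    have hx1 : ‖x‖ ≤ 1 := by nlinarith [norm_nonneg x]
    have hcx : c * ‖x‖ ≤ 1 / 2 := by nlinarith [norm_nonneg x]
    have hdrift := drift_lyapQuad_le h 1 hb hx1 (hF x i)
    rw [← hc, Pi.one_apply, one_mul] at hdrift
    have hcube : c * ‖x‖ ^ 3 ≤ 1 / 2 * ‖x‖ ^ 2 := by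
      rw [pow_succ', ← mul_assoc]
      gcongr
    rw [generator]
    linarith

end Drift

namespace Plant

section TerminalCost

variable {n m ν : ℕ} (S : Plant n m ν) (K : Fin ν → (Vec n →L[ℝ] Vec m)) (β : Fin ν → ℝ≥0)
  (α : ℝ)

theorem costTerm_eq (x : Vec n) (ω : ModePath ν) (k : ℕ) :
    S.costTerm K β α x ω k =
      1 / 2 * ((α + β (ω k)) * ‖linFlow (S.Gamma K) ω k x‖ ^ 2) +
        inner ℝ (S.q K (ω k)) (linFlow (S.Gamma K) ω k x) := by
  rw [costTerm, ellQ, flow_eq_linFlow, inner_smul_right, real_inner_self_eq_norm_sq]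

theorem integrable_costTerm (x : Vec n) (i : Fin ν) (k : ℕ) :
    Integrable (fun ω => S.costTerm K β α x ω k) (chainLaw S.P i) :=
  integrable_flow_mode _ _ x i (S.ellQ K β α) k

theorem integral_costTerm (x : Vec n) (i : Fin ν) (k : ℕ) :
    ∫ ω, S.costTerm K β α x ω k ∂(chainLaw S.P i) =
      1 / 2 * inner ℝ x (stageOp S.P (S.Gamma K) (fun j => β j) i k x) +
        1 / 2 * α * inner ℝ x (stageOp S.P (S.Gamma K) 1 i k x) +
        inner ℝ (stageVec S.P (S.Gamma K) (S.q K) i k) x := by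
  have hint (g : (Vec n →L[ℝ] Vec n) → Fin ν → ℝ) :=
    integrable_linFlow_mode (S.Gamma K) S.P g k i
  simp only [inner_stageOp, inner_stageVec, real_inner_self_eq_norm_sq, Pi.one_apply, one_mul]
  rw [← integral_const_mul, ← integral_const_mul,
    ← integral_add (hint fun A j => 1 / 2 * (β j * ‖A x‖ ^ 2))
      (hint fun A _ => 1 / 2 * α * ‖A x‖ ^ 2),
    ← integral_add (hint fun A j => 1 / 2 * (β j * ‖A x‖ ^ 2) + 1 / 2 * α * ‖A x‖ ^ 2)
      (hint fun A j => inner ℝ (S.q K j) (A x))]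
  refine integral_congr_ae (Eventually.of_forall fun ω => ?_)
  simp only [costTerm_eq]
  ring

theorem norm_costTerm_le (x : Vec n) (ω : ModePath ν) (k : ℕ) :
    ‖S.costTerm K β α x ω k‖ ≤
      1 / 2 * (|α| + ∑ j, (β j : ℝ)) * ‖x‖ ^ 2 * ‖linFlow (S.Gamma K) ω k‖ ^ 2 +
        ‖S.q K‖ * ‖x‖ * ‖linFlow (S.Gamma K) ω k‖ := by
  have hflow := (linFlow (S.Gamma K) ω k).le_opNorm x
  have hβ : |(β (ω k) : ℝ)| ≤ ∑ j, (β j : ℝ) := by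
    rw [NNReal.abs_eq]
    exact Finset.single_le_sum (f := fun j => (β j : ℝ)) (fun j _ => (β j).2) (Finset.mem_univ _)
  have hquad : ‖1 / 2 * ((α + β (ω k)) * ‖linFlow (S.Gamma K) ω k x‖ ^ 2)‖ ≤
      1 / 2 * ((|α| + ∑ j, (β j : ℝ)) * (‖linFlow (S.Gamma K) ω k‖ * ‖x‖) ^ 2) := by
    rw [norm_mul, norm_mul, norm_pow, norm_norm, Real.norm_of_nonneg one_half_pos.le,
      Real.norm_eq_abs]
    gcongr
    exact (abs_add_le _ _).trans (by gcongr)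
  have hlin : ‖(inner ℝ (S.q K (ω k)) (linFlow (S.Gamma K) ω k x) : ℝ)‖ ≤
      ‖S.q K‖ * (‖linFlow (S.Gamma K) ω k‖ * ‖x‖) := by
    refine (norm_inner_le_norm _ _).trans ?_
    gcongr
    exact norm_le_pi_norm (S.q K) _
  rw [costTerm_eq]
  linarith [norm_add_le (1 / 2 * ((α + β (ω k)) * ‖linFlow (S.Gamma K) ω k x‖ ^ 2))
    (inner ℝ (S.q K (ω k)) (linFlow (S.Gamma K) ω k x))]

variable {S K}

theorem summable_integral_norm_costTerm (hK : S.IsMSStabilizing K) (x : Vec n) (i : Fin ν) :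
    Summable fun k => ∫ ω, ‖S.costTerm K β α x ω k‖ ∂(chainLaw S.P i) := by
  have hint (g : (Vec n →L[ℝ] Vec n) → Fin ν → ℝ) (k : ℕ) :=
    integrable_linFlow_mode (S.Gamma K) S.P g k i
  set a := 1 / 2 * (|α| + ∑ j, (β j : ℝ)) * ‖x‖ ^ 2
  have : 0 ≤ a := by positivity
  refine Summable.of_nonneg_of_le (fun k => integral_nonneg fun ω => norm_nonneg _) (fun k => ?_)
    (((summable_flowMoment hK).mul_left a).add
      ((summable_sqrt_flowMoment hK).mul_left (‖S.q K‖ * ‖x‖)))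
  calc ∫ ω, ‖S.costTerm K β α x ω k‖ ∂(chainLaw S.P i)
      ≤ ∫ ω, (a * ‖linFlow (S.Gamma K) ω k‖ ^ 2 + ‖S.q K‖ * ‖x‖ * ‖linFlow (S.Gamma K) ω k‖)
          ∂(chainLaw S.P i) :=
        integral_mono (S.integrable_costTerm K β α x i k).norm
          (hint (fun A _ => a * ‖A‖ ^ 2 + ‖S.q K‖ * ‖x‖ * ‖A‖) k)
          (S.norm_costTerm_le K β α x · k)
    _ ≤ a * flowMoment (S.Gamma K) S.P k + ‖S.q K‖ * ‖x‖ * √(flowMoment (S.Gamma K) S.P k) := by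
        rw [integral_add (hint (fun A _ => a * ‖A‖ ^ 2) k)
          (hint (fun A _ => ‖S.q K‖ * ‖x‖ * ‖A‖) k), integral_const_mul, integral_const_mul]
        gcongr
        · exact integral_sq_norm_linFlow_le _ _ k i
        · exact integral_norm_linFlow_le _ _ k i

theorem ae_summable_costTerm (hK : S.IsMSStabilizing K) (x : Vec n) (i : Fin ν) :
    ∀ᵐ ω ∂(chainLaw S.P i), Summable (S.costTerm K β α x ω) := by
  obtain ⟨_, -, hsum⟩ := exists_integrable_ae_hasSum (S.integrable_costTerm K β α x i)
    (summable_integral_norm_costTerm β α hK x i)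
  exact hsum.mono fun _ hω => hω.summable

theorem integrable_tsum_costTerm (hK : S.IsMSStabilizing K) (x : Vec n) (i : Fin ν) :
    Integrable (fun ω => ∑' k, S.costTerm K β α x ω k) (chainLaw S.P i) := by
  obtain ⟨_, hint, hsum⟩ := exists_integrable_ae_hasSum (S.integrable_costTerm K β α x i)
    (summable_integral_norm_costTerm β α hK x i)
  exact hint.congr (hsum.mono fun _ hω => hω.tsum_eq.symm)

theorem Vf_eq (hK : S.IsMSStabilizing K) (x : Vec n) (i : Fin ν) :
    S.Vf K β α x i = 1 / 2 * lyapQuad S.P (S.Gamma K) (fun j => β j) x i +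
      1 / 2 * α * lyapQuad S.P (S.Gamma K) 1 x i + lyapLin S.P (S.Gamma K) (S.q K) x i := by
  have hsum := hasSum_integral_of_summable_integral_norm (S.integrable_costTerm K β α x i)
    (summable_integral_norm_costTerm β α hK x i)
  simp only [integral_costTerm] at hsum
  exact hsum.unique ((((hasSum_inner_stageOp _ hK i x x).mul_left _).add
    ((hasSum_inner_stageOp _ hK i x x).mul_left _)).add (hasSum_inner_stageVec _ hK i x))

theorem neg_norm_mul_le_Vf (hK : S.IsMSStabilizing K) (hα : 0 ≤ α) {δ : ℝ} {x : Vec n}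
    (hx : ‖x‖ ≤ δ) (i : Fin ν) : -(‖lyapVec S.P (S.Gamma K) (S.q K)‖ * δ) ≤ S.Vf K β α x i := by
  have hquad {w : Fin ν → ℝ} (hw : ∀ j, 0 ≤ w j) : 0 ≤ lyapQuad S.P (S.Gamma K) w x i :=
    (isPositive_lyapOp hw hK i).inner_nonneg_right x
  have hβ := hquad (w := fun j => β j) fun j => (β j).2
  have hone := mul_nonneg hα (hquad (w := 1) fun _ => zero_le_one)
  have hlin : |lyapLin S.P (S.Gamma K) (S.q K) x i| ≤ ‖lyapVec S.P (S.Gamma K) (S.q K)‖ * δ := by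
    refine (abs_real_inner_le_norm _ _).trans ?_
    gcongr
    exact norm_le_pi_norm (lyapVec S.P (S.Gamma K) (S.q K)) i
  rw [Vf_eq β α hK]
  linarith [neg_le_of_abs_le hlin]

theorem generator_Vf (hK : S.IsMSStabilizing K) (F : Vec n → Fin ν → Vec n) (x : Vec n)
    (i : Fin ν) :
    generator S.P F (S.Vf K β α) x i =
      1 / 2 * generator S.P F (lyapQuad S.P (S.Gamma K) (fun j => β j)) x i +
        1 / 2 * α * generator S.P F (lyapQuad S.P (S.Gamma K) 1) x i +
        generator S.P F (lyapLin S.P (S.Gamma K) (S.q K)) x i := by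
  simp only [generator, funext₂ (Vf_eq β α hK), drift_add, drift_const_mul]

end TerminalCost

section TerminalDecrease

variable {n m ν : ℕ} {S : Plant n m ν} {K : Fin ν → (Vec n →L[ℝ] Vec m)} {βf βl : Fin ν → ℝ≥0}

theorem hasFDerivAt_closedLoop {i : Fin ν}
    (hdiff : DifferentiableAt ℝ (fun p : Vec n × Vec m => S.f p.1 p.2 i) 0) :
    HasFDerivAt (fun x => S.closedLoop (kappaF K) x i) (S.Gamma K i) 0 := by
  obtain ⟨D, hD⟩ := hdiff
  have hcomp {E : Type} [NormedAddCommGroup E] [NormedSpace ℝ E] (L : E →L[ℝ] Vec n × Vec m) :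
      HasFDerivAt (fun z => S.f (L z).1 (L z).2 i) (D.comp L) 0 :=
    HasFDerivAt.comp (g := fun p : Vec n × Vec m => S.f p.1 p.2 i) (f := L) 0
      (by rwa [map_zero]) L.hasFDerivAt
  have hA : S.A i = D.comp (ContinuousLinearMap.inl ℝ (Vec n) (Vec m)) :=
    (hcomp (ContinuousLinearMap.inl ℝ (Vec n) (Vec m))).fderiv
  have hB : S.B i = D.comp (ContinuousLinearMap.inr ℝ (Vec n) (Vec m)) :=
    (hcomp (ContinuousLinearMap.inr ℝ (Vec n) (Vec m))).fderiv
  have hΓ : S.Gamma K i = D.comp ((ContinuousLinearMap.id ℝ (Vec n)).prod (K i)) := by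
    rw [Gamma, hA, hB]
    ext1 x
    simp [← map_add]
  rw [hΓ]
  exact hcomp ((ContinuousLinearMap.id ℝ (Vec n)).prod (K i))

theorem norm_closedLoop_sub_le (h0 : ∀ i, S.f 0 0 i = 0)
    (hdiff : ∀ i, DifferentiableAt ℝ (fun p : Vec n × Vec m => S.f p.1 p.2 i) 0)
    (hf : ∀ i, BetaSmooth (βf i) (fun x => S.closedLoop (kappaF K) x i)) (x : Vec n)
    (i : Fin ν) :
    ‖S.closedLoop (kappaF K) x i - S.Gamma K i x‖ ≤ (∑ j, (βf j : ℝ)) * ‖x‖ ^ 2 := by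
  have htaylor := (hf i).norm_sub_sub_fderiv_le x
  have hzero : S.closedLoop (kappaF K) 0 i = 0 := by rw [closedLoop, kappaF, map_zero, h0]
  rw [(hasFDerivAt_closedLoop (hdiff i)).fderiv, hzero, sub_zero] at htaylor
  refine htaylor.trans ?_
  gcongr
  exact Finset.single_le_sum (f := fun j => (βf j : ℝ)) (fun j _ => (βf j).2) (Finset.mem_univ i)

theorem ellBar_le {i : Fin ν} (hl : BetaSmooth (βl i) (fun x => S.ellBar K x i)) (x : Vec n) :
    S.ellBar K x i ≤ inner ℝ (S.q K i) x + βl i * ‖x‖ ^ 2 := by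
  have htaylor := (le_abs_self _).trans (hl.norm_sub_sub_fderiv_le x)
  have hzero : S.ellBar K 0 i = 0 := by rw [ellBar, kappaF, map_zero, sub_self]
  have hq : inner ℝ (S.q K i) x = fderiv ℝ (fun x => S.ellBar K x i) 0 x :=
    InnerProductSpace.toDual_symm_apply
  linarith

theorem exists_generator_Vf_le (hK : S.IsMSStabilizing K) {F : Vec n → Fin ν → Vec n} {b δ : ℝ}
    (hb : 0 ≤ b) (hF : ∀ x i, ‖F x i - S.Gamma K i x‖ ≤ b * ‖x‖ ^ 2) (hδ : δ ≤ 1)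
    (hdec : ∀ i, ∀ x ∈ Metric.ball (0 : Vec n) δ,
      generator S.P F (lyapQuad S.P (S.Gamma K) 1) x i ≤ -(1 / 2 * ‖x‖ ^ 2))
    (hl : ∀ i, BetaSmooth (βl i) (fun x => S.ellBar K x i)) :
    ∃ α₀ : ℝ, 0 < α₀ ∧ ∀ α : ℝ, α₀ ≤ α → ∀ i, ∀ x ∈ Metric.ball (0 : Vec n) δ,
      generator S.P F (S.Vf K βl α) x i ≤ -S.ellBar K x i := by
  obtain ⟨c, hc⟩ : ∃ c, c = ‖modeAvg S.P (lyapOp S.P (S.Gamma K) (fun j => βl j))‖ *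
    (2 * ‖S.Gamma K‖ + b) * b := ⟨_, rfl⟩
  obtain ⟨d, hd⟩ : ∃ d, d = ‖modeAvg S.P (lyapVec S.P (S.Gamma K) (S.q K))‖ * b := ⟨_, rfl⟩
  have hc0 : 0 ≤ c := by rw [hc]; positivity
  have hd0 : 0 ≤ d := by rw [hd]; positivity
  refine ⟨4 * (c + ∑ j, (βl j : ℝ) + d) + 1, by positivity, fun α hα i x hx => ?_⟩
  have hx1 : ‖x‖ ≤ 1 := (mem_ball_zero_iff.1 hx).le.trans hδ
  have hquad := drift_lyapQuad_le hK (fun j => (βl j : ℝ)) hb hx1 (hF x i)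
  have hlin := drift_lyapLin_le hK (S.q K) (hF x i)
  rw [← hc] at hquad
  rw [← hd] at hlin
  have hcube : c * ‖x‖ ^ 3 ≤ c * ‖x‖ ^ 2 := by
    gcongr ?_ * ?_
    exact pow_le_pow_of_le_one (norm_nonneg x) hx1 (Nat.le_succ 2)
  have hβ : (βl i : ℝ) ≤ ∑ j, (βl j : ℝ) :=
    Finset.single_le_sum (f := fun j => (βl j : ℝ)) (fun j _ => (βl j).2) (Finset.mem_univ i)
  have hα0 : 0 ≤ α := le_trans (by positivity) hα
  have hαdec := mul_le_mul_of_nonneg_left (hdec i x hx) (mul_nonneg one_half_pos.le hα0)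
  have hαx : (c + βl i + d) * ‖x‖ ^ 2 ≤ 1 / 4 * α * ‖x‖ ^ 2 := by
    gcongr
    linarith
  rw [generator_Vf βl α hK]
  have hcx : 0 ≤ c * ‖x‖ ^ 2 := by positivity
  have hβx : 0 ≤ (βl i : ℝ) * ‖x‖ ^ 2 := by positivity
  have hellBar := ellBar_le (hl i) x
  simp only [generator] at hαdec ⊢
  linarith

end TerminalDecrease

end Plant

namespace Plant

section OpenLoop

variable {n m ν : ℕ} {S : Plant n m ν} {u : ℕ → ModePath ν → Vec m}

theorem dependsOn_openLoop (hu : ∀ k, DependsOn (u k) (Set.Iic k)) (x : Vec n) (k : ℕ) :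
    DependsOn (fun ω => S.openLoop x u ω k) (Set.Iio k) :=
  dependsOn_of_recursion (step := fun k y ω => S.f y (u k ω) (ω k)) (fun _ => rfl)
    (fun _ _ => rfl) (fun k y _ _ h => congrArg₂ (S.f y) (hu k h) (h k Set.self_mem_Iic)) k

theorem dependsOn_openLoop_input_mode {E : Type*} (hu : ∀ k, DependsOn (u k) (Set.Iic k))
    (x : Vec n) (g : Vec n → Vec m → Fin ν → E) (k : ℕ) :
    DependsOn (fun ω => g (S.openLoop x u ω k) (u k ω) (ω k)) (Set.Iic k) := fun ω ω' h => by
  have hstate : S.openLoop x u ω k = S.openLoop x u ω' k :=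
    dependsOn_openLoop hu x k fun l hl => h l (Set.Iio_subset_Iic_self hl)
  simp only [hstate, hu k h, h k Set.self_mem_Iic]

variable (S) in
/-- The realised cost `V(x_N, θ_N) + ∑_{k<N} ell(x_k, u_k, θ_k)` of the policy `u` along one mode
path; `horizonCost` is its expectation. -/
def pathCost (N : ℕ) (V : Vec n → Fin ν → ℝ) (x : Vec n) (u : ℕ → ModePath ν → Vec m)
    (ω : ModePath ν) : ℝ :=
  V (S.openLoop x u ω N) (ω N) +
    ∑ k ∈ Finset.range N, S.ell (S.openLoop x u ω k) (u k ω) (ω k)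

theorem dependsOn_pathCost (hu : ∀ k, DependsOn (u k) (Set.Iic k)) (N : ℕ)
    (V : Vec n → Fin ν → ℝ) (x : Vec n) : DependsOn (S.pathCost N V x u) (Set.Iic N) :=
  fun _ _ h => congrArg₂ (· + ·)
    (dependsOn_openLoop_input_mode hu x (fun y _ i => V y i) N h)
    (Finset.sum_congr rfl fun k hk => dependsOn_openLoop_input_mode hu x S.ell k fun l hl =>
      h l (hl.trans (Finset.mem_range.1 hk).le))

theorem integrable_pathCost (hu : ∀ k, DependsOn (u k) (Set.Iic k)) (N : ℕ)
    (V : Vec n → Fin ν → ℝ) (x : Vec n) (i : Fin ν) :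
    Integrable (S.pathCost N V x u) (chainLaw S.P i) :=
  integrable_of_dependsOn (dependsOn_pathCost hu N V x) _

/-- The policy that remains of `u` one step later, when the first mode was `i`. -/
def shiftPolicy (i : Fin ν) (u : ℕ → ModePath ν → Vec m) (k : ℕ) (ω : ModePath ν) : Vec m :=
  u (k + 1) (consPath i ω)

theorem dependsOn_shiftPolicy (hu : ∀ k, DependsOn (u k) (Set.Iic k)) (i : Fin ν) (k : ℕ) :
    DependsOn (shiftPolicy i u k) (Set.Iic k) :=
  dependsOn_comp_consPath (hu (k + 1)) i

variable {i : Fin ν} {v : Vec m}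

theorem openLoop_consPath_succ (hv : ∀ ω, u 0 (consPath i ω) = v) (x : Vec n) (ω : ModePath ν)
    (k : ℕ) :
    S.openLoop x u (consPath i ω) (k + 1) = S.openLoop (S.f x v i) (shiftPolicy i u) ω k := by
  induction k with
  | zero => exact congrArg (S.f x · i) (hv ω)
  | succ k ih =>
    rw [openLoop, ih]
    rfl

theorem pathCost_consPath (hv : ∀ ω, u 0 (consPath i ω) = v) (M : ℕ) (V : Vec n → Fin ν → ℝ)
    (x : Vec n) (ω : ModePath ν) :
    S.pathCost (M + 1) V x u (consPath i ω) =
      S.ell x v i + S.pathCost M V (S.f x v i) (shiftPolicy i u) ω := by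
  simp only [pathCost, Finset.sum_range_succ', openLoop_consPath_succ hv, consPath_succ,
    consPath_zero, hv, shiftPolicy]
  simp only [openLoop]
  ring

theorem horizonCost_succ (hu : ∀ k, DependsOn (u k) (Set.Iic k))
    (hv : ∀ ω, u 0 (consPath i ω) = v) (M : ℕ) (V : Vec n → Fin ν → ℝ) (x : Vec n) :
    S.horizonCost (M + 1) V x i u = S.ell x v i +
      modeAvg S.P (fun j => S.horizonCost M V (S.f x v i) j (shiftPolicy i u)) i := by
  have htail (j : Fin ν) :
      ∫ ω, S.pathCost (M + 1) V x u (consPath i ω) ∂(chainLaw S.P j) =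
        S.ell x v i + S.horizonCost M V (S.f x v i) j (shiftPolicy i u) := by
    simp only [pathCost_consPath hv]
    rw [integral_add (integrable_const _)
      (integrable_pathCost (dependsOn_shiftPolicy hu i) M V _ j), integral_const, probReal_univ,
      one_smul]
    rfl
  rw [← modeAvg_const S.P i (S.ell x v i), ← modeAvg_add, ← funext htail]
  exact integral_chainLaw (dependsOn_pathCost hu (M + 1) V x) S.P i

theorem first_input_eq (hu : DependsOn (u 0) (Set.Iic 0))
    (hv : ∀ᵐ ω ∂(chainLaw S.P i), u 0 ω = v) (ω : ModePath ν) : u 0 (consPath i ω) = v := by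
  obtain ⟨ω', rfl, hω'⟩ := (hv.and (ae_mode_zero S.P i)).exists
  refine hu fun l hl => ?_
  rw [Nat.le_zero.1 hl, hω', consPath_zero]

variable {N M : ℕ} {Xf : Fin ν → Set (Vec n)} {x : Vec n}

theorem Feasible.dependsOn (h : S.Feasible N Xf x i u) (k : ℕ) : DependsOn (u k) (Set.Iic k) :=
  (h.causal k).dependsOn_of_piLE

theorem Feasible.first_mem (h : S.Feasible (M + 1) Xf x i u)
    (hv : ∀ᵐ ω ∂(chainLaw S.P i), u 0 ω = v) : (x, v) ∈ S.Y i := by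
  obtain ⟨ω, hstage, rfl, rfl⟩ := (h.stage.and (hv.and (ae_mode_zero S.P i))).exists
  exact hstage 0 M.succ_pos

theorem Feasible.shift (h : S.Feasible (M + 1) Xf x i u)
    (hv : ∀ᵐ ω ∂(chainLaw S.P i), u 0 ω = v) {j : Fin ν} (hij : 0 < S.P.1 i j) :
    S.Feasible M Xf (S.f x v i) j (shiftPolicy i u) where
  causal k := measurable_of_dependsOn (dependsOn_shiftPolicy h.dependsOn i k)
  stage := by
    filter_upwards [ae_chainLaw_iff.1 h.stage j hij] with ω hω k hk
    rw [← openLoop_consPath_succ (first_input_eq (h.dependsOn 0) hv)]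
    exact hω (k + 1) (Nat.succ_lt_succ hk)
  terminal := by
    filter_upwards [ae_chainLaw_iff.1 h.terminal j hij] with ω hω
    rwa [← openLoop_consPath_succ (first_input_eq (h.dependsOn 0) hv)]

theorem Feasible.le_horizonCost (h : S.Feasible N Xf x i u) {V : Vec n → Fin ν → ℝ} {b c : ℝ}
    (hV : ∀ i, ∀ x ∈ Xf i, b ≤ V x i) (hell : ∀ i x u, (x, u) ∈ S.Y i → c ≤ S.ell x u i) :
    b + N * c ≤ S.horizonCost N V x i u := by
  have hpath : ∀ᵐ ω ∂(chainLaw S.P i), b + N * c ≤ S.pathCost N V x u ω := by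
    filter_upwards [h.stage, h.terminal] with ω hstage hterminal
    refine add_le_add (hV _ _ hterminal) ?_
    simpa only [Finset.card_range, nsmul_eq_mul] using
      Finset.card_nsmul_le_sum (Finset.range N) _ c fun k hk =>
        hell _ _ _ (hstage k (Finset.mem_range.1 hk))
  have hintegral := integral_mono_ae (integrable_const (b + N * c))
    (integrable_pathCost h.dependsOn N V x i) hpath
  rwa [integral_const, probReal_univ, one_smul] at hintegral

end OpenLoop

section TerminalLaw

variable {n m ν : ℕ} {S : Plant n m ν} {κf : Vec n → Fin ν → Vec m}
  {Xf : Fin ν → Set (Vec n)} {M : ℕ} {x : Vec n} {i : Fin ν} {u : ℕ → ModePath ν → Vec m}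

variable (S κf) in
/-- Follow `u` for `M` steps from the state `x`, then apply the terminal law `κf`. Only the first
`M + 1` inputs are meaningful: the later ones feed `κf` with the states generated by `u`. -/
def extendPolicy (M : ℕ) (x : Vec n) (u : ℕ → ModePath ν → Vec m) (k : ℕ) (ω : ModePath ν) :
    Vec m :=
  if k < M then u k ω else κf (S.openLoop x u ω k) (ω k)

theorem extendPolicy_of_lt {k : ℕ} (hk : k < M) (ω : ModePath ν) :
    S.extendPolicy κf M x u k ω = u k ω := if_pos hk

theorem extendPolicy_self (ω : ModePath ν) :
    S.extendPolicy κf M x u M ω = κf (S.openLoop x u ω M) (ω M) := if_neg M.lt_irrefl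

theorem openLoop_extendPolicy {k : ℕ} (hk : k ≤ M) (ω : ModePath ν) :
    S.openLoop x (S.extendPolicy κf M x u) ω k = S.openLoop x u ω k := by
  induction k with
  | zero => rfl
  | succ k ih => rw [openLoop, openLoop, ih (Nat.le_of_succ_le hk), extendPolicy_of_lt hk]

theorem openLoop_extendPolicy_succ (ω : ModePath ν) :
    S.openLoop x (S.extendPolicy κf M x u) ω (M + 1) =
      S.closedLoop κf (S.openLoop x u ω M) (ω M) := by
  rw [openLoop, openLoop_extendPolicy le_rfl, extendPolicy_self, closedLoop]

theorem Feasible.extend (hinv : ∀ i j, 0 < S.P.1 i j → ∀ x ∈ Xf i, S.closedLoop κf x i ∈ Xf j)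
    (hadm : ∀ i, ∀ x ∈ Xf i, (x, κf x i) ∈ S.Y i) (h : S.Feasible M Xf x i u) :
    S.Feasible (M + 1) Xf x i (S.extendPolicy κf M x u) where
  causal k := by
    refine measurable_of_dependsOn (k := k) ?_
    unfold extendPolicy
    split_ifs
    · exact h.dependsOn k
    · exact dependsOn_openLoop_input_mode h.dependsOn x (fun y _ i => κf y i) k
  stage := by
    filter_upwards [h.stage, h.terminal] with ω hstage hterminal k hk
    rcases Nat.lt_succ_iff_lt_or_eq.1 hk with hkM | rfl
    · rw [openLoop_extendPolicy hkM.le, extendPolicy_of_lt hkM]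
      exact hstage k hkM
    · rw [openLoop_extendPolicy le_rfl, extendPolicy_self]
      exact hadm _ _ hterminal
  terminal := by
    filter_upwards [h.terminal, ae_transition_pos S.P i] with ω hterminal hpos
    rw [openLoop_extendPolicy_succ]
    exact hinv _ _ (hpos M) _ hterminal

theorem subset_feasibleSet (hinv : ∀ i j, 0 < S.P.1 i j → ∀ x ∈ Xf i, S.closedLoop κf x i ∈ Xf j)
    (hadm : ∀ i, ∀ x ∈ Xf i, (x, κf x i) ∈ S.Y i) (N : ℕ) (i : Fin ν) :
    Xf i ⊆ S.feasibleSet N Xf i := by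
  intro x hx
  induction N with
  | zero =>
    exact ⟨0, fun _ => measurable_const,
      Eventually.of_forall fun _ _ hk => (Nat.not_lt_zero _ hk).elim,
      (ae_mode_zero S.P i).mono fun _ hω => hω ▸ hx⟩
  | succ N ih => exact ih.imp' _ fun _ hu => hu.extend hinv hadm

theorem horizonCost_extendPolicy (hu : ∀ k, DependsOn (u k) (Set.Iic k)) (V : Vec n → Fin ν → ℝ) :
    S.horizonCost (M + 1) V x i (S.extendPolicy κf M x u) = S.horizonCost M V x i u +
      ∫ ω, (generator S.P (S.closedLoop κf) V (S.openLoop x u ω M) (ω M) +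
        S.ell (S.openLoop x u ω M) (κf (S.openLoop x u ω M) (ω M)) (ω M)) ∂(chainLaw S.P i) := by
  let increment (j : Fin ν) (ω : ModePath ν) : ℝ :=
    V (S.closedLoop κf (S.openLoop x u ω M) (ω M)) j - V (S.openLoop x u ω M) (ω M) +
      S.ell (S.openLoop x u ω M) (κf (S.openLoop x u ω M) (ω M)) (ω M)
  have hincrement (j : Fin ν) : DependsOn (increment j) (Set.Iic M) :=
    dependsOn_openLoop_input_mode hu x
      (fun y _ i => V (S.closedLoop κf y i) j - V y i + S.ell y (κf y i) i) M
  have hnext : DependsOn (fun ω => increment (ω (M + 1)) ω) (Set.Iic (M + 1)) := fun ω ω' h => by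
    simp only [h (M + 1) Set.self_mem_Iic]
    exact hincrement _ fun l hl => h l (Set.Iic_subset_Iic.2 M.le_succ hl)
  have hpath (ω : ModePath ν) : S.pathCost (M + 1) V x (S.extendPolicy κf M x u) ω =
      S.pathCost M V x u ω + increment (ω (M + 1)) ω := by
    have hstage : ∀ k ∈ Finset.range M, S.ell (S.openLoop x (S.extendPolicy κf M x u) ω k)
        (S.extendPolicy κf M x u k ω) (ω k) = S.ell (S.openLoop x u ω k) (u k ω) (ω k) :=
      fun k hk => by
        have hkM := Finset.mem_range.1 hk
        rw [openLoop_extendPolicy hkM.le, extendPolicy_of_lt hkM]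
    simp only [pathCost, increment, Finset.sum_range_succ, Finset.sum_congr rfl hstage,
      openLoop_extendPolicy_succ, openLoop_extendPolicy le_rfl, extendPolicy_self]
    ring
  calc S.horizonCost (M + 1) V x i (S.extendPolicy κf M x u)
      = ∫ ω, (S.pathCost M V x u ω + increment (ω (M + 1)) ω) ∂(chainLaw S.P i) :=
        integral_congr_ae (Eventually.of_forall hpath)
    _ = S.horizonCost M V x i u +
          ∫ ω, modeAvg S.P (fun j => increment j ω) (ω M) ∂(chainLaw S.P i) := by
        rw [integral_add (integrable_pathCost hu M V x i) (integrable_of_dependsOn hnext _),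
          integral_markov S.P i hincrement]
        rfl
    _ = _ := by simp only [increment, modeAvg_add, modeAvg_sub, modeAvg_const, generator, drift_eq]

theorem Feasible.horizonCost_extendPolicy_le {V : Vec n → Fin ν → ℝ}
    (hdec : ∀ i, ∀ x ∈ Xf i, generator S.P (S.closedLoop κf) V x i ≤ -S.ell x (κf x i) i)
    (h : S.Feasible M Xf x i u) :
    S.horizonCost (M + 1) V x i (S.extendPolicy κf M x u) ≤ S.horizonCost M V x i u := by
  rw [horizonCost_extendPolicy h.dependsOn, add_le_iff_nonpos_right]
  refine integral_nonpos_of_ae ?_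
  filter_upwards [h.terminal] with ω hω
  exact le_neg_iff_add_nonpos_right.1 (hdec _ _ hω)

end TerminalLaw

section RecedingHorizon

variable {n m ν : ℕ} {S : Plant n m ν} {κf κ : Vec n → Fin ν → Vec m}
  {Xf : Fin ν → Set (Vec n)} {M N : ℕ} {V : Vec n → Fin ν → ℝ}

theorem IsMPCLaw.mem_Y (hκ : S.IsMPCLaw (M + 1) V Xf κ) {i : Fin ν} {x : Vec n}
    (hx : x ∈ S.feasibleSet (M + 1) Xf i) : (x, κ x i) ∈ S.Y i := by
  obtain ⟨u, hu, hu0⟩ := hκ i x hx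
  exact hu.1.first_mem hu0

theorem IsMPCLaw.closedLoop_mem_feasibleSet (hκ : S.IsMPCLaw (M + 1) V Xf κ)
    (hinv : ∀ i j, 0 < S.P.1 i j → ∀ x ∈ Xf i, S.closedLoop κf x i ∈ Xf j)
    (hadm : ∀ i, ∀ x ∈ Xf i, (x, κf x i) ∈ S.Y i) (i j : Fin ν) (hij : 0 < S.P.1 i j) (x : Vec n)
    (hx : x ∈ S.feasibleSet (M + 1) Xf i) :
    S.closedLoop κ x i ∈ S.feasibleSet (M + 1) Xf j := by
  obtain ⟨u, hu, hu0⟩ := hκ i x hx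
  exact ⟨_, (hu.1.shift hu0 hij).extend hinv hadm⟩

theorem IsMPCLaw.isUPI_feasibleSet (hκ : S.IsMPCLaw (M + 1) V Xf κ)
    (hUPI : IsUPI S.P (S.closedLoop κf) Xf) (hadm : ∀ i, ∀ x ∈ Xf i, (x, κf x i) ∈ S.Y i) :
    IsUPI S.P (S.closedLoop κ) (S.feasibleSet (M + 1) Xf) :=
  ⟨fun i => (hUPI.1 i).mono (subset_feasibleSet hUPI.2 hadm (M + 1) i),
    hκ.closedLoop_mem_feasibleSet hUPI.2 hadm⟩

variable (S) in
/-- The optimal cost of the horizon-`N` problem. It is the true infimum at the states where the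
problem has an optimizer, in particular at every feasible state when there is an MPC law; elsewhere
`sInf` may return the junk value `0`. -/
noncomputable def valueFn (N : ℕ) (V : Vec n → Fin ν → ℝ) (Xf : Fin ν → Set (Vec n)) (x : Vec n)
    (i : Fin ν) : ℝ :=
  sInf (S.horizonCost N V x i '' {u | S.Feasible N Xf x i u})

theorem IsOptimizer.valueFn_eq {x : Vec n} {i : Fin ν} {u : ℕ → ModePath ν → Vec m}
    (hu : S.IsOptimizer N V Xf x i u) : S.valueFn N V Xf x i = S.horizonCost N V x i u :=
  IsLeast.csInf_eq ⟨⟨u, hu.1, rfl⟩, Set.forall_mem_image.2 hu.2⟩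

theorem IsMPCLaw.valueFn_le (hκ : S.IsMPCLaw N V Xf κ) {x : Vec n} {i : Fin ν}
    {u : ℕ → ModePath ν → Vec m} (hu : S.Feasible N Xf x i u) :
    S.valueFn N V Xf x i ≤ S.horizonCost N V x i u := by
  obtain ⟨w, hw, -⟩ := hκ i x ⟨u, hu⟩
  exact hw.valueFn_eq.trans_le (hw.2 u hu)

theorem IsMPCLaw.generator_valueFn_le (hκ : S.IsMPCLaw (M + 1) V Xf κ)
    (hinv : ∀ i j, 0 < S.P.1 i j → ∀ x ∈ Xf i, S.closedLoop κf x i ∈ Xf j)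
    (hadm : ∀ i, ∀ x ∈ Xf i, (x, κf x i) ∈ S.Y i)
    (hdec : ∀ i, ∀ x ∈ Xf i, generator S.P (S.closedLoop κf) V x i ≤ -S.ell x (κf x i) i)
    {i : Fin ν} {x : Vec n} (hx : x ∈ S.feasibleSet (M + 1) Xf i) :
    generator S.P (S.closedLoop κ) (S.valueFn (M + 1) V Xf) x i ≤ -S.ell x (κ x i) i := by
  obtain ⟨u, hu, hu0⟩ := hκ i x hx
  have htail : modeAvg S.P (S.valueFn (M + 1) V Xf (S.closedLoop κ x i)) i ≤
      modeAvg S.P (fun j => S.horizonCost M V (S.closedLoop κ x i) j (shiftPolicy i u)) i :=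
    modeAvg_mono fun j hij =>
      have hshift := hu.1.shift hu0 hij
      (hκ.valueFn_le (hshift.extend hinv hadm)).trans (hshift.horizonCost_extendPolicy_le hdec)
  have hsucc :=
    horizonCost_succ (S := S) hu.1.dependsOn (first_input_eq (hu.1.dependsOn 0) hu0) M V x
  rw [← closedLoop] at hsucc
  rw [generator, drift_eq, hu.valueFn_eq, hsucc]
  linarith

theorem IsMPCLaw.isMSStableOn_feasibleSet (hκ : S.IsMPCLaw (M + 1) V Xf κ)
    (hinv : ∀ i j, 0 < S.P.1 i j → ∀ x ∈ Xf i, S.closedLoop κf x i ∈ Xf j)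
    (hadm : ∀ i, ∀ x ∈ Xf i, (x, κf x i) ∈ S.Y i)
    (hdec : ∀ i, ∀ x ∈ Xf i, generator S.P (S.closedLoop κf) V x i ≤ -S.ell x (κf x i) i)
    {b c d γ : ℝ} (hV : ∀ i, ∀ x ∈ Xf i, b ≤ V x i)
    (hell : ∀ i x u, (x, u) ∈ S.Y i → c ≤ S.ell x u i)
    {lam : Vec n → Fin ν → ℝ} (hlam : ∀ i x u, (x, u) ∈ S.Y i → d ≤ lam x i) (hγ : 0 < γ)
    (hdiss : ∀ i x u, (x, u) ∈ S.Y i →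
      drift S.P lam (S.f x u i) x i ≤ S.ell x u i - γ * ‖x‖ ^ 2) :
    IsMSStableOn S.P (S.closedLoop κ) (S.feasibleSet (M + 1) Xf) := by
  refine isMSStableOn_of_lyapunov (W := fun x i => S.valueFn (M + 1) V Xf x i + lam x i)
    (c := b + (M + 1 : ℕ) * c + d) (hκ.closedLoop_mem_feasibleSet hinv hadm) hγ
    (fun i x hx => ?_) fun i x hx => ?_
  · obtain ⟨u, hu, -⟩ := hκ i x hx
    rw [hu.valueFn_eq]
    exact add_le_add (hu.1.le_horizonCost hV hell) (hlam i x _ (hκ.mem_Y hx))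
  · have hvalue := hκ.generator_valueFn_le hinv hadm hdec hx
    have hstorage := hdiss i x (κ x i) (hκ.mem_Y hx)
    rw [generator] at hvalue
    rw [generator, drift_add]
    change _ + drift S.P lam (S.f x (κ x i) i) x i ≤ _
    linarith

end RecedingHorizon

section CostOffset

variable {n m ν : ℕ} {S : Plant n m ν} {N : ℕ} {V : Vec n → Fin ν → ℝ}
  {Xf : Fin ν → Set (Vec n)} {x : Vec n} {i : Fin ν} {u : ℕ → ModePath ν → Vec m}

variable (S) in
/-- The plant with the stage cost lowered by a constant in each mode; with `c i = ell(0, 0, i)` the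
equilibrium costs nothing. The inputs cannot influence the modes, so the optimizers are the same. -/
def subModeCost (c : Fin ν → ℝ) : Plant n m ν :=
  { S with ell := fun x u i => S.ell x u i - c i }

theorem openLoop_subModeCost (c : Fin ν → ℝ) : (S.subModeCost c).openLoop = S.openLoop := by
  funext x u ω k
  induction k with
  | zero => rfl
  | succ k ih => rw [openLoop, openLoop, ih, subModeCost]

theorem feasible_subModeCost_iff {c : Fin ν → ℝ} :
    (S.subModeCost c).Feasible N Xf x i u ↔ S.Feasible N Xf x i u := by
  have hopen := openLoop_subModeCost (S := S) c
  constructor <;> rintro ⟨hcausal, hstage, hterminal⟩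
  · rw [hopen] at hstage hterminal
    exact ⟨hcausal, hstage, hterminal⟩
  · rw [← hopen] at hstage hterminal
    exact ⟨hcausal, hstage, hterminal⟩

theorem feasibleSet_subModeCost (c : Fin ν → ℝ) :
    (S.subModeCost c).feasibleSet N Xf = S.feasibleSet N Xf := by
  funext i
  simp only [feasibleSet, feasible_subModeCost_iff]

theorem pathCost_subModeCost (c : Fin ν → ℝ) (ω : ModePath ν) :
    (S.subModeCost c).pathCost N V x u ω =
      S.pathCost N V x u ω - ∑ k ∈ Finset.range N, c (ω k) := by
  rw [pathCost, pathCost, openLoop_subModeCost, add_sub_assoc, ← Finset.sum_sub_distrib]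
  rfl

theorem horizonCost_subModeCost (hu : ∀ k, DependsOn (u k) (Set.Iic k)) (c : Fin ν → ℝ) :
    (S.subModeCost c).horizonCost N V x i u =
      S.horizonCost N V x i u - ∫ ω, ∑ k ∈ Finset.range N, c (ω k) ∂(chainLaw S.P i) := by
  have hc : Integrable (fun ω => ∑ k ∈ Finset.range N, c (ω k)) (chainLaw S.P i) :=
    integrable_finsetSum _ fun k _ => integrable_of_dependsOn (dependsOn_mode c k) _
  exact (integral_congr_ae (Eventually.of_forall (pathCost_subModeCost c))).trans
    (integral_sub (integrable_pathCost hu N V x i) hc)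

theorem IsMPCLaw.subModeCost {κ : Vec n → Fin ν → Vec m} (hκ : S.IsMPCLaw N V Xf κ)
    (c : Fin ν → ℝ) : (S.subModeCost c).IsMPCLaw N V Xf κ := by
  intro i x hx
  obtain ⟨u, hu, hu0⟩ := hκ i x (feasibleSet_subModeCost c ▸ hx)
  refine ⟨u, ⟨feasible_subModeCost_iff.2 hu.1, fun w hw => ?_⟩, hu0⟩
  have hwS := feasible_subModeCost_iff.1 hw
  rw [horizonCost_subModeCost hu.1.dependsOn, horizonCost_subModeCost hwS.dependsOn]
  exact sub_le_sub_right (hu.2 w hwS) _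

end CostOffset

section Dissipativity

variable {n m ν : ℕ} {S : Plant n m ν} {lam : Vec n → Fin ν → ℝ} {γ : ℝ}

variable (S) in
/-- Stochastic dissipativity with the quadratic rate `γ‖x‖²`, relative to the cost of the origin,
and with a storage function that is bounded below on the admissible states. -/
structure QuadraticallyDissipative (lam : Vec n → Fin ν → ℝ) (γ : ℝ) : Prop where
  lam_bddBelow : ∃ d, ∀ i x u, (x, u) ∈ S.Y i → d ≤ lam x i
  dissipation : ∀ i x u, (x, u) ∈ S.Y i →
    drift S.P lam (S.f x u i) x i ≤ S.ell x u i - S.ell 0 0 i - γ * ‖x‖ ^ 2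

theorem StrictlyDissipative.quadraticallyDissipative {rho : Vec n → Fin ν → ℝ}
    (h : S.StrictlyDissipative lam rho) (hY : ∀ i, IsCompact (S.Y i))
    (hrho : ∀ x i, γ * ‖x‖ ^ 2 ≤ rho x i) : S.QuadraticallyDissipative lam γ where
  lam_bddBelow := by
    have hbdd (i : Fin ν) : BddBelow ((fun x => lam x i) '' (Prod.fst '' S.Y i)) :=
      ((h.lam_lsc i).lowerSemicontinuousOn _).bddBelow_of_isCompact
        ((hY i).image continuous_fst)
    choose d hd using hbdd
    obtain ⟨b, hb⟩ := (Set.finite_range d).bddBelow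
    exact ⟨b, fun i x u hxu => (hb ⟨i, rfl⟩).trans (hd i ⟨x, ⟨(x, u), hxu, rfl⟩, rfl⟩)⟩
  dissipation i x u hxu := (h.dissipation i x u hxu).trans (sub_le_sub_left (hrho x i) _)

theorem QuadraticallyDissipative.isMSStableOn_feasibleSet {κf κ : Vec n → Fin ν → Vec m}
    {Xf : Fin ν → Set (Vec n)} {M : ℕ} {V : Vec n → Fin ν → ℝ} {b c : ℝ}
    (hdiss : S.QuadraticallyDissipative lam γ) (hγ : 0 < γ)
    (hell : ∀ i x u, (x, u) ∈ S.Y i → c ≤ S.ell x u i)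
    (hinv : ∀ i j, 0 < S.P.1 i j → ∀ x ∈ Xf i, S.closedLoop κf x i ∈ Xf j)
    (hadm : ∀ i, ∀ x ∈ Xf i, (x, κf x i) ∈ S.Y i)
    (hdec : ∀ i, ∀ x ∈ Xf i,
      generator S.P (S.closedLoop κf) V x i ≤ -(S.ell x (κf x i) i - S.ell 0 0 i))
    (hV : ∀ i, ∀ x ∈ Xf i, b ≤ V x i) (hκ : S.IsMPCLaw (M + 1) V Xf κ) :
    IsMSStableOn S.P (S.closedLoop κ) (S.feasibleSet (M + 1) Xf) := by
  obtain ⟨d, hd⟩ := hdiss.lam_bddBelow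
  rw [← feasibleSet_subModeCost (S.ell 0 0)]
  refine (hκ.subModeCost (S.ell 0 0)).isMSStableOn_feasibleSet (c := c - ‖S.ell 0 0‖)
    hinv hadm hdec hV (fun i x u hxu => ?_) hd hγ hdiss.dissipation
  exact sub_le_sub (hell i x u hxu) ((le_abs_self _).trans (norm_le_pi_norm (S.ell 0 0) i))

end Dissipativity

end Plant

end EMPC

theorem mainTheorem4_general {n m ν : ℕ} (S : Plant n m ν) {c : ℝ}
    (hell : ∀ i x u, (x, u) ∈ S.Y i → c ≤ S.ell x u i) (h0 : ∀ i, S.f 0 0 i = 0)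
    (hdiff : ∀ i, DifferentiableAt ℝ (fun p : Vec n × Vec m => S.f p.1 p.2 i) 0)
    (K : Fin ν → (Vec n →L[ℝ] Vec m)) (βf βl : Fin ν → ℝ≥0)
    (hf : ∀ i, BetaSmooth (βf i) (fun x => S.closedLoop (Plant.kappaF K) x i))
    (hl : ∀ i, BetaSmooth (βl i) (fun x => S.ellBar K x i))
    (hK : S.IsMSStabilizing K) :
    (∃ (PI Pβ : Fin ν → (Vec n →L[ℝ] Vec n)) (p : Fin ν → Vec n),
      (∀ i, (PI i).IsPositive ∧ (Pβ i).IsPositive) ∧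
      (∀ i, PI i = ContinuousLinearMap.id ℝ (Vec n) +
        (ContinuousLinearMap.adjoint (S.Gamma K i)).comp
          ((modeAvg S.P PI i).comp (S.Gamma K i))) ∧
      (∀ i, Pβ i = (βl i : ℝ) • ContinuousLinearMap.id ℝ (Vec n) +
        (ContinuousLinearMap.adjoint (S.Gamma K i)).comp
          ((modeAvg S.P Pβ i).comp (S.Gamma K i))) ∧
      (∀ i, p i = S.q K i + ContinuousLinearMap.adjoint (S.Gamma K i) (modeAvg S.P p i)) ∧
      ∀ (α : ℝ) x i,
        (∀ᵐ ω ∂(chainLaw S.P i), Summable (fun k => S.costTerm K βl α x ω k)) ∧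
        Integrable (fun ω => ∑' k, S.costTerm K βl α x ω k) (chainLaw S.P i) ∧
        S.Vf K βl α x i = 1 / 2 * inner ℝ x ((Pβ i + α • PI i) x) + inner ℝ (p i) x) ∧
    ∃ δ : ℝ, 0 < δ ∧ ∃ α₀ : ℝ, 0 < α₀ ∧ ∀ α : ℝ, α₀ ≤ α →
      (∀ i, ∀ x ∈ Metric.ball (0 : Vec n) δ,
        generator S.P (S.closedLoop (Plant.kappaF K)) (S.Vf K βl α) x i ≤ -S.ellBar K x i) ∧
      ∀ Xf : Fin ν → Set (Vec n),
        IsUPI S.P (S.closedLoop (Plant.kappaF K)) Xf →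
        (∀ i, ∀ x ∈ Xf i, (x, Plant.kappaF K x i) ∈ S.Y i) →
        (∀ i, Xf i ⊆ Metric.ball (0 : Vec n) δ) →
        IsMSStableOn S.P (S.closedLoop (Plant.kappaF K)) Xf ∧
        ∀ N : ℕ, 1 ≤ N →
          (∀ i, Xf i ⊆ S.feasibleSet N Xf i) ∧
          ∀ κN : Vec n → Fin ν → Vec m, S.IsMPCLaw N (S.Vf K βl α) Xf κN →
            IsUPI S.P (S.closedLoop κN) (S.feasibleSet N Xf) ∧
            ∀ (lam : Vec n → Fin ν → ℝ) (γ : ℝ), S.QuadraticallyDissipative lam γ → 0 < γ →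
              IsMSStableOn S.P (S.closedLoop κN) (S.feasibleSet N Xf) := by
  refine ⟨⟨lyapOp S.P (S.Gamma K) 1, lyapOp S.P (S.Gamma K) (fun j => βl j),
    lyapVec S.P (S.Gamma K) (S.q K),
    fun i => ⟨isPositive_lyapOp (fun _ => zero_le_one) hK i,
      isPositive_lyapOp (fun j => (βl j).2) hK i⟩,
    fun i => by simpa only [Pi.one_apply, one_smul] using lyapOp_eq 1 hK i,
    lyapOp_eq _ hK, lyapVec_eq _ hK, fun α x i => ⟨Plant.ae_summable_costTerm βl α hK x i,
      Plant.integrable_tsum_costTerm βl α hK x i, ?_⟩⟩, ?_⟩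
  · rw [Plant.Vf_eq βl α hK, lyapQuad, lyapQuad, lyapLin, add_apply, smul_apply, inner_add_right,
      inner_smul_right]
    ring
  have hb : 0 ≤ ∑ j, (βf j : ℝ) := Finset.sum_nonneg fun j _ => (βf j).2
  have hrem := Plant.norm_closedLoop_sub_le h0 hdiff hf
  obtain ⟨δ, hδ, hδ1, hquad⟩ := exists_ball_generator_lyapQuad_le hK hb hrem
  obtain ⟨α₀, hα₀, hdec⟩ := Plant.exists_generator_Vf_le hK hb hrem hδ1 hquad hl
  refine ⟨δ, hδ, α₀, hα₀, fun α hα => ⟨hdec α hα, fun Xf hUPI hadm hball => ⟨?_, ?_⟩⟩⟩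
  · exact isMSStableOn_of_lyapunov hUPI.2 one_half_pos
      (fun i x _ => (isPositive_lyapOp (fun _ => zero_le_one) hK i).inner_nonneg_right x)
      fun i x hx => hquad i x (hball i hx)
  · rintro (_ | M) hN
    · exact absurd hN (Nat.not_succ_le_zero 0)
    refine ⟨Plant.subset_feasibleSet hUPI.2 hadm _, fun κN hκ =>
      ⟨hκ.isUPI_feasibleSet hUPI hadm, fun lam γ hdiss hγ => ?_⟩⟩
    exact hdiss.isMSStableOn_feasibleSet hγ hell hUPI.2 hadm
      (fun i x hx => hdec α hα i x (hball i hx))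
      (fun i x hx => Plant.neg_norm_mul_le_Vf βl α hK (hα₀.le.trans hα)
        (mem_ball_zero_iff.1 (hball i hx)).le i) hκ

theorem mainTheorem4 {n m ν : ℕ} (S : Plant n m ν)
    (hwp : S.WellPosed) (heq : S.CommonEquilibrium)
    (hdiff : ∀ i, DifferentiableAt ℝ (fun p : Vec n × Vec m => S.f p.1 p.2 i) 0)
    (K : Fin ν → (Vec n →L[ℝ] Vec m)) (βf βl : Fin ν → ℝ≥0)
    (hf : ∀ i, BetaSmooth (βf i) (fun x => S.closedLoop (Plant.kappaF K) x i))
    (hl : ∀ i, BetaSmooth (βl i) (fun x => S.ellBar K x i))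
    (hK : S.IsMSStabilizing K) :
    -- the terminal cost is well defined and quadratic-plus-linear, for every `α > 0`
    (∃ (PI Pβ : Fin ν → (Vec n →L[ℝ] Vec n)) (p : Fin ν → Vec n),
      (∀ i, (PI i).IsPositive ∧ (Pβ i).IsPositive) ∧
      (∀ i, PI i = ContinuousLinearMap.id ℝ (Vec n) +
        (ContinuousLinearMap.adjoint (S.Gamma K i)).comp
          ((modeAvg S.P PI i).comp (S.Gamma K i))) ∧
      (∀ i, Pβ i = (βl i : ℝ) • ContinuousLinearMap.id ℝ (Vec n) +
        (ContinuousLinearMap.adjoint (S.Gamma K i)).comp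
          ((modeAvg S.P Pβ i).comp (S.Gamma K i))) ∧
      (∀ i, p i = S.q K i + ContinuousLinearMap.adjoint (S.Gamma K i) (modeAvg S.P p i)) ∧
      ∀ α : ℝ, 0 < α → ∀ x i,
        (∀ᵐ ω ∂(chainLaw S.P i), Summable (fun k => S.costTerm K βl α x ω k)) ∧
        Integrable (fun ω => ∑' k, S.costTerm K βl α x ω k) (chainLaw S.P i) ∧
        S.Vf K βl α x i = 1 / 2 * inner ℝ x ((Pβ i + α • PI i) x) + inner ℝ (p i) x) ∧
    ∃ δ : ℝ, 0 < δ ∧ ∃ α₀ : ℝ, 0 < α₀ ∧ ∀ α : ℝ, α₀ ≤ α →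
      -- the terminal decrease condition on the ball
      (∀ i, ∀ x ∈ Metric.ball (0 : Vec n) δ,
        generator S.P (S.closedLoop (Plant.kappaF K)) (S.Vf K βl α) x i ≤ -S.ellBar K x i) ∧
      -- local mean square stability
      ∀ Xf : Fin ν → Set (Vec n),
        IsUPI S.P (S.closedLoop (Plant.kappaF K)) Xf →
        (∀ i, ∀ x ∈ Xf i, (x, Plant.kappaF K x i) ∈ S.Y i) →
        (∀ i, Xf i ⊆ Metric.ball (0 : Vec n) δ) →
        ∀ (lam rho : Vec n → Fin ν → ℝ) (γ : ℝ), S.StrictlyDissipative lam rho →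
          0 < γ → (∀ x i, γ * ‖x‖ ^ 2 ≤ rho x i) →
          IsMSStableOn S.P (S.closedLoop (Plant.kappaF K)) Xf ∧
          ∀ N : ℕ, 1 ≤ N →
            (∀ i, Xf i ⊆ S.feasibleSet N Xf i) ∧
            ∀ κN : Vec n → Fin ν → Vec m, S.IsMPCLaw N (S.Vf K βl α) Xf κN →
              IsUPI S.P (S.closedLoop κN) (S.feasibleSet N Xf) ∧
              IsMSStableOn S.P (S.closedLoop κN) (S.feasibleSet N Xf) := by
  obtain ⟨hcost, δ, hδ, α₀, hα₀, hstable⟩ := mainTheorem4_general S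
    (fun i x u _ => hwp.ell_nonneg x u i) (fun i => (heq i).1.1) hdiff K βf βl hf hl hK
  obtain ⟨PI, Pβ, p, hpos, hPI, hPβ, hp, hV⟩ := hcost
  refine ⟨⟨PI, Pβ, p, hpos, hPI, hPβ, hp, fun α _ => hV α⟩, δ, hδ, α₀, hα₀, fun α hα =>
    ⟨(hstable α hα).1, fun Xf hUPI hadm hball lam rho γ hdiss hγ hrho => ?_⟩⟩
  obtain ⟨hXf, hMPC⟩ := (hstable α hα).2 Xf hUPI hadm hball
  have hquad := hdiss.quadraticallyDissipative hwp.Y_compact hrho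
  exact ⟨hXf, fun N hN => (hMPC N hN).imp_right fun h κN hκ =>
    (h κN hκ).imp_right fun hstab => hstab lam γ hquad hγ⟩
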